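/- **Definitions.** *Cartan schemes.* A *generalized Cartan matrix* indexed by $I$ is an integral matrix $(c_{ij})_{i,j\in I}$ with $c_{ii}=2$, $c_{ij}\le 0$ for $i\ne j$, and $c_{ij}=0\Rightarrow c_{ji}=0$; it is *decomposable* if $I$ is the disjoint union of two non-empty subsets such that $c_{ij}=c_{ji}=0$ whenever $i$ and $j$ lie in different ones. A *Cartan scheme* $\mathcal C=\mathcal C(I,A,(\rho_i)_{i\in I},(C^a)_{a\in A})$ consists of an index set $I$, a non-empty set $A$ of objects, maps $\rho_i:A\to A$ with $\rho_i^2=\mathrm{id}$, and generalized Cartan matrices $C^a=(c^a_{ij})_{i,j\in I}$ with $c^{\rho_i(a)}_{ij}=c^a_{ij}$ for all $a\in A$ and $i,j\in I$. It has rank two if $|I|=2$. Let $(\alpha_i)_{i\in I}$ be the standard basis of $\mathbb Z^I$ and let $\sigma_i^a\in\mathrm{Aut}(\mathbb Z^I)$ be given by $\sigma_i^a(\alpha_j)=\alpha_j-c^a_{ij}\alpha_i$. The *Weyl groupoid* of $\mathcal C$ has the set of objects $A$, and its morphisms are generated by the maps $\sigma_i^a$, viewed as morphisms $a\to\rho_i(a)$.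 The scheme (or its Weyl groupoid) is *connected* if there is a morphism between any two objects, *universal* (simply connected) if every object has only the trivial endomorphism, and *irreducible* if no $C^a$ is decomposable. A *root system of type* $\mathcal C$ is a family $(R^a)_{a\in A}$ of subsets of $\mathbb Z^I$ such that, with $R^a_+=R^a\cap\mathbb N_0^I$: 1. $R^a=R^a_+\cup -R^a_+$; 2. $R^a\cap\mathbb Z\alpha_i=\{\alpha_i,-\alpha_i\}$; 3. $\sigma_i^a(R^a)=R^{\rho_i(a)}$; 4. if $i\neq j$ and $m=|R^a\cap(\mathbb N_0\alpha_i+\mathbb N_0\alpha_j)|$ is finite, then $(\rho_i\rho_j)^{m}(a)=a$. It is *finite* if every $R^a$ is finite. Two Cartan schemes are *equivalent* (their Weyl groupoids are regarded as isomorphic) if there are bijections $e$ between their index sets and $\varphi$ between their sets of objects such that $\varphi(\rho_i(a))=\rho'_{e(i)}(\varphi(a))$ and $c'^{\,\varphi(a)}_{e(i)e(j)}=c^a_{ij}$ for all $i,j,a$. If $I=\{i,j\}$ and $a\in A$, put $a_1=a$, $a_2=\rho_i(a_1)$, $a_3=\rho_j(a_2)$, $a_4=\rho_i(a_3)$, …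 alternately, and, for given $n$, let $\Phi(i,a)=(c_1,\dots,c_n)$ with $c_1=-c^{a_1}_{ij}$, $c_2=-c^{a_2}_{ji}$, $c_3=-c^{a_3}_{ij}$, … . *η-sequences.* For $x\in\mathbb Z$ let $\eta(x)=\begin{pmatrix}x&-1\\1&0\end{pmatrix}$. Let $\mathcal A^+$ be the set of finite sequences $(c_1,\dots,c_n)$, $n\ge1$, of integers $c_i\ge1$ such that $\eta(c_1)\cdots\eta(c_n)=-\mathrm{id}$ and, for all $i<n$, the entries of the first column of $\eta(c_1)\cdots\eta(c_i)$ are non-negative. The *η-sequences* are the sequences obtained from $(1,1,1)$ by repeatedly applying $(c_1,\dots,c_n)\mapsto(c_2,\dots,c_n,c_1)$, $(c_1,\dots,c_n)\mapsto(c_n,\dots,c_1)$ and $(c_1,\dots,c_n)\mapsto(c_1+1,1,c_2+1,c_3,\dots,c_n)$. *Triangulations.* For $n\ge3$ let $\mathcal T_n$ be the set of triangulations of a convex $n$-gon, with vertices labelled $1,\dots,n$ in cyclic order, by non-intersecting diagonals, i.e. maximal sets of pairwise non-crossing diagonals. Let $\mathcal T=\bigcup_{n\ge3}\mathcal T_n$,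 and let $\mathbb D_n$ be the dihedral group of symmetries of the $n$-gon, acting on $\mathcal T_n$. **Theorem.** 1. $\mathcal A^+$ is the set of η-sequences. 2. For every $c=(c_1,\dots,c_n)\in\mathcal A^+$ there is exactly one triangulation $\Psi(c)\in\mathcal T$ that is a triangulation of the $n$-gon having exactly $c_i$ triangles at the vertex $i$ for $i=1,\dots,n$. The resulting map $\Psi:\mathcal A^+\to\mathcal T$ is a bijection. 3. Every connected irreducible universal Cartan scheme of rank two that admits a finite root system has exactly $2n$ objects for some $n\ge3$. For every $n\ge3$ there is a bijection from the set of isomorphism classes of connected irreducible universal Weyl groupoids of rank two with $2n$ objects which admit a finite root system (that is, equivalence classes of the corresponding Cartan schemes) to the set $\mathcal T_n/\mathbb D_n$ of triangulations of a convex $n$-gon up to the dihedral group. It sends the class of the Weyl groupoid of $\mathcal C$ to the class of $\Psi(\Phi(i,a))$, where $\Phi(i,a)\in\mathcal A^+$ for every $i\in I$ and every object $a$, and the class does not depend on the choice of $(i,a)$. -/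

import Mathlib

open CategoryTheory

universe u v

/-! ### Cartan schemes, their Weyl groupoids and root systems -/

/-- A generalized Cartan matrix: integral, with diagonal entries `2`, nonpositive entries off the
diagonal, and symmetric vanishing pattern. -/
structure IsGenCartanMatrix {I : Type u} (M : Matrix I I ℤ) : Prop where
  diag : ∀ i, M i i = 2
  nonpos : ∀ i j, i ≠ j → M i j ≤ 0
  zero_symm : ∀ i j, M i j = 0 → M j i = 0

/-- A matrix is indecomposable if there is no partition of the index set into two nonempty parts
such that all entries connecting the two parts vanish. -/
def IsIndecomposable {I : Type u} (M : Matrix I I ℤ) : Prop :=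
  ∀ J : Set I, J.Nonempty → Jᶜ.Nonempty → ∃ i ∈ J, ∃ j ∈ Jᶜ, M i j ≠ 0 ∨ M j i ≠ 0

/-- A Cartan scheme with index set `I` and set of objects `A`. -/
structure CartanScheme (I : Type u) (A : Type v) where
  nonempty : Nonempty A
  ρ : I → A → A
  cartan : A → Matrix I I ℤ
  isGenCartanMatrix : ∀ a, IsGenCartanMatrix (cartan a)
  ρ_ρ : ∀ i a, ρ i (ρ i a) = a
  cartan_ρ : ∀ i j a, cartan a i j = cartan (ρ i a) i j

namespace CartanScheme

variable {I : Type u} {A : Type v}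

/-- The standard basis vector `α_i` of `ℤ^I`. -/
noncomputable def α (i : I) : I →₀ ℤ := Finsupp.single i 1

/-- The linear form on `ℤ^I` given by `α_j ↦ c_{ij}^a`. -/
noncomputable def coroot (C : CartanScheme I A) (i : I) (a : A) : (I →₀ ℤ) →ₗ[ℤ] ℤ :=
  Finsupp.linearCombination ℤ (C.cartan a i)

theorem coroot_α (C : CartanScheme I A) (i j : I) (a : A) :
    C.coroot i a (α j) = C.cartan a i j := by
  simp [coroot, α]

theorem coroot_α_self (C : CartanScheme I A) (i : I) (a : A) : C.coroot i a (α i) = 2 := by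
  rw [coroot_α, (C.isGenCartanMatrix a).diag]

/-- The reflection `σ_i^a` of `ℤ^I`. -/
noncomputable def σ (C : CartanScheme I A) (i : I) (a : A) : (I →₀ ℤ) ≃ₗ[ℤ] (I →₀ ℤ) :=
  Module.reflection (C.coroot_α_self i a)

theorem σ_α (C : CartanScheme I A) (i j : I) (a : A) :
    C.σ i a (α j) = α j - C.cartan a i j • α i := by
  rw [σ, Module.reflection_apply, coroot_α]

/-- `C.IsMor a b f` says that the automorphism `f` of `ℤ^I` is a morphism from `a` to `b` in the
Weyl groupoid of `C`: it is a product of reflections `σ_i^c : c → ρ_i(c)` leading from `a` to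
`b`. -/
inductive IsMor (C : CartanScheme I A) (a : A) : A → ((I →₀ ℤ) ≃ₗ[ℤ] (I →₀ ℤ)) → Prop
  | refl : IsMor C a a (LinearEquiv.refl ℤ (I →₀ ℤ))
  | step (b : A) (f : (I →₀ ℤ) ≃ₗ[ℤ] (I →₀ ℤ)) (i : I) :
      IsMor C a b f → IsMor C a (C.ρ i b) (f.trans (C.σ i b))

theorem IsMor.trans {C : CartanScheme I A} {a b c : A} {f g : (I →₀ ℤ) ≃ₗ[ℤ] (I →₀ ℤ)}
    (hf : C.IsMor a b f) (hg : C.IsMor b c g) : C.IsMor a c (f.trans g) := by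
  induction hg with
  | refl => exact hf
  | step c g i _ ih => exact IsMor.step c (f.trans g) i ih

theorem σ_ρ (C : CartanScheme I A) (i : I) (a : A) : C.σ i (C.ρ i a) = (C.σ i a).symm := by
  have h : C.coroot i (C.ρ i a) = C.coroot i a := by
    unfold coroot
    congr 1
    funext j
    exact (C.cartan_ρ i j a).symm
  have h1 : C.σ i (C.ρ i a) = C.σ i a := by
    ext1 j
    simp only [σ, Module.reflection_apply, h]
  rw [h1]
  exact (Module.reflection_symm (C.coroot_α_self i a)).symm

theorem IsMor.symm {C : CartanScheme I A} {a b : A} {f : (I →₀ ℤ) ≃ₗ[ℤ] (I →₀ ℤ)}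
    (hf : C.IsMor a b f) : C.IsMor b a f.symm := by
  induction hf with
  | refl => exact IsMor.refl
  | step b f i _ ih =>
    have h := IsMor.step (C.ρ i b) _ i (IsMor.refl (C := C) (a := C.ρ i b))
    rw [C.ρ_ρ, σ_ρ] at h
    exact h.trans ih

/-- The type of objects of the Weyl groupoid of `C`. -/
def WeylGroupoid (_C : CartanScheme I A) : Type v := A

/-- The Weyl groupoid of `C`. -/
noncomputable instance (C : CartanScheme I A) : Groupoid.{u} C.WeylGroupoid where
  Hom a b := {f : (I →₀ ℤ) ≃ₗ[ℤ] (I →₀ ℤ) // C.IsMor a b f}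
  id _ := ⟨LinearEquiv.refl ℤ _, IsMor.refl⟩
  comp f g := ⟨f.1.trans g.1, f.2.trans g.2⟩
  id_comp _ := rfl
  comp_id _ := rfl
  assoc _ _ _ := rfl
  inv f := ⟨f.1.symm, f.2.symm⟩
  inv_comp f := Subtype.ext (LinearEquiv.symm_trans_self f.1)
  comp_inv f := Subtype.ext (LinearEquiv.self_trans_symm f.1)

/-- `C` is connected if its Weyl groupoid is. -/
def IsConnected (C : CartanScheme I A) : Prop :=
  ∀ a b : C.WeylGroupoid, Nonempty (a ⟶ b)

/-- `C` is simply connected (its Weyl groupoid is universal) if every object has only the trivial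
endomorphism. -/
def IsSimplyConnected (C : CartanScheme I A) : Prop :=
  ∀ a : C.WeylGroupoid, ∀ f : a ⟶ a, f = 𝟙 a

/-- `C` is irreducible if none of its Cartan matrices is decomposable. -/
def IsIrreducible (C : CartanScheme I A) : Prop :=
  ∀ a, IsIndecomposable (C.cartan a)

/-- The elements of `S ⊆ ℤ^I` with nonnegative coordinates. -/
def positivePart (S : Set (I →₀ ℤ)) : Set (I →₀ ℤ) := {v ∈ S | ∀ k, 0 ≤ v k}

/-- The set `S ∩ (ℕ₀ α_i + ℕ₀ α_j)`. -/
def planePart (S : Set (I →₀ ℤ)) (i j : I) : Set (I →₀ ℤ) :=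
  {v ∈ S | ∃ p q : ℕ, v = p • α i + q • α j}

/-- The family `R` of subsets of `ℤ^I` is a root system of type `C`. -/
structure IsRootSystem (C : CartanScheme I A) (R : A → Set (I →₀ ℤ)) : Prop where
  pos_or_neg : ∀ a, R a = positivePart (R a) ∪ {v | -v ∈ positivePart (R a)}
  reduced : ∀ a i, R a ∩ {v | ∃ z : ℤ, v = z • α i} = {α i, -α i}
  image_σ : ∀ a i, C.σ i a '' R a = R (C.ρ i a)
  iterate_ρ : ∀ a i j, i ≠ j → (planePart (R a) i j).Finite →
    (C.ρ i ∘ C.ρ j)^[(planePart (R a) i j).ncard] a = a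

/-- `C` admits a finite root system. -/
def HasFiniteRootSystem (C : CartanScheme I A) : Prop :=
  ∃ R : A → Set (I →₀ ℤ), C.IsRootSystem R ∧ ∀ a, (R a).Finite

/-- Equivalence of Cartan schemes: bijections of the index sets and of the sets of objects that
are compatible with the maps `ρ_i` and with the Cartan matrices. -/
def Equivalent {I' : Type u} {A' : Type v} (C : CartanScheme I A) (C' : CartanScheme I' A') :
    Prop :=
  ∃ (e : I ≃ I') (φ : A ≃ A'),
    (∀ i a, φ (C.ρ i a) = C'.ρ (e i) (φ a)) ∧
    ∀ i j a, C'.cartan (φ a) (e i) (e j) = C.cartan a i j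

/-- The sequence `(c_1, …, c_n)` of negated Cartan entries met when starting at the object `a` and
applying `ρ_i, ρ_j, ρ_i, …` alternately: with `a_1 = a`, `a_2 = ρ_i(a_1)`, `a_3 = ρ_j(a_2)`, …
one has `c_1 = -c^{a_1}_{ij}`, `c_2 = -c^{a_2}_{ji}`, `c_3 = -c^{a_3}_{ij}`, … -/
def entrySeq (C : CartanScheme I A) : ℕ → I → I → A → List ℤ
  | 0, _, _, _ => []
  | n + 1, i, j, a => -C.cartan a i j :: entrySeq C n j i (C.ρ i a)

end CartanScheme

/-- A connected irreducible simply connected (universal) Cartan scheme of rank two with `2n`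
objects admitting a finite root system. -/
structure UniversalRankTwo (n : ℕ) : Type (max (u + 1) (v + 1)) where
  I : Type u
  A : Type v
  scheme : CartanScheme I A
  rank_two : Nat.card I = 2
  card_objects : Nat.card A = 2 * n
  connected : scheme.IsConnected
  simplyConnected : scheme.IsSimplyConnected
  irreducible : scheme.IsIrreducible
  finiteRootSystem : scheme.HasFiniteRootSystem

/-- Two such Cartan schemes (Weyl groupoids) are identified if they are equivalent. -/
instance UniversalRankTwo.setoid (n : ℕ) : Setoid (UniversalRankTwo.{u, v} n) where
  r X Y := X.scheme.Equivalent Y.scheme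
  iseqv :=
    { refl := fun _ => ⟨Equiv.refl _, Equiv.refl _, fun _ _ => rfl, fun _ _ _ => rfl⟩
      symm := by
        rintro X Y ⟨e, φ, h1, h2⟩
        refine ⟨e.symm, φ.symm, fun i a => ?_, fun i j a => ?_⟩
        · rw [Equiv.symm_apply_eq, h1]
          simp
        · rw [← h2]
          simp
      trans := by
        rintro X Y Z ⟨e, φ, h1, h2⟩ ⟨e', φ', h1', h2'⟩
        refine ⟨e.trans e', φ.trans φ', fun i a => ?_, fun i j a => ?_⟩
        · simp [h1, h1']
        · simp [h2, h2'] }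

/-! ### η-sequences -/

def etaMatrix (x : ℤ) : Matrix (Fin 2) (Fin 2) ℤ := !![x, -1; 1, 0]

/-- The set `𝒜⁺` of sequences `(c_1, …, c_n)`, `n ≥ 1`, of positive integers such that
`η(c_1) ⋯ η(c_n) = -id` and, for `i < n`, the first column of `η(c_1) ⋯ η(c_i)` is nonnegative. -/
structure IsAPlus (c : List ℤ) : Prop where
  ne_nil : c ≠ []
  prod_eq : (c.map etaMatrix).prod = -1
  one_le : ∀ x ∈ c, 1 ≤ x
  col_nonneg : ∀ i < c.length, ∀ k : Fin 2, 0 ≤ ((c.take i).map etaMatrix).prod k 0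

/-- The recursive description of η-sequences. -/
inductive IsEtaSeq : List ℤ → Prop
  | triangle : IsEtaSeq [1, 1, 1]
  | rotate (a : ℤ) (l : List ℤ) : IsEtaSeq (a :: l) → IsEtaSeq (l ++ [a])
  | reverse (l : List ℤ) : IsEtaSeq l → IsEtaSeq l.reverse
  | insert (a b : ℤ) (l : List ℤ) :
      IsEtaSeq (a :: b :: l) → IsEtaSeq ((a + 1) :: 1 :: (b + 1) :: l)

/-! ### Triangulations of a convex polygon -/

/-- For vertices of a convex `n`-gon labelled in cyclic order by `Fin n`: the segments `ab` and
`cd` cross in their interiors, i.e. `c` and `d` lie strictly on different sides of `ab`. -/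
def Crossing {n : ℕ} (a b c d : Fin n) : Prop :=
  (sbtw a c b ∧ sbtw b d a) ∨ (sbtw a d b ∧ sbtw b c a)

/-- A triangulation of a convex `n`-gon with labelled vertices: a maximal set of pairwise
non-crossing diagonals. The chosen diagonals are the edges of the graph `diag`; the sides of the
polygon are the edges of `SimpleGraph.cycleGraph n`. -/
@[ext]
structure Triangulation (n : ℕ) where
  diag : SimpleGraph (Fin n)
  not_side : ∀ a b, diag.Adj a b → ¬ (SimpleGraph.cycleGraph n).Adj a b
  noncrossing : ∀ a b c d, diag.Adj a b → diag.Adj c d → ¬ Crossing a b c d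
  maximal : ∀ a b, a ≠ b → ¬ (SimpleGraph.cycleGraph n).Adj a b →
    (∀ c d, diag.Adj c d → ¬ Crossing a b c d) → diag.Adj a b

/-- The number of triangles of the triangulation at the vertex `i`: the triples of vertices
containing `i` any two of which are joined by a side of the polygon or by a diagonal of the
triangulation. -/
noncomputable def Triangulation.numTriangles {n : ℕ} (T : Triangulation n) (i : Fin n) : ℕ :=
  {s : Finset (Fin n) | (SimpleGraph.cycleGraph n ⊔ T.diag).IsNClique 3 s ∧ i ∈ s}.ncard

/-- The dihedral group of symmetries of the `n`-gon, as a group of permutations of its vertices,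
generated by the rotation `i ↦ i + 1` and the reflection `i ↦ n - 1 - i`. -/
def dihedralPerms (n : ℕ) : Subgroup (Equiv.Perm (Fin n)) :=
  Subgroup.closure {finRotate n, Fin.revPerm}

/-- Two triangulations of the `n`-gon are identified if a dihedral symmetry maps one to the
other. -/
instance Triangulation.setoid (n : ℕ) : Setoid (Triangulation n) where
  r S T := ∃ g ∈ dihedralPerms n, ∀ a b, T.diag.Adj (g a) (g b) ↔ S.diag.Adj a b
  iseqv :=
    { refl := fun _ => ⟨1, one_mem _, fun _ _ => Iff.rfl⟩
      symm := by
        rintro S T ⟨g, hg, h⟩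
        exact ⟨g⁻¹, inv_mem hg, fun a b => by rw [← h]; simp⟩
      trans := by
        rintro S T U ⟨g, hg, h⟩ ⟨g', hg', h'⟩
        exact ⟨g' * g, mul_mem hg' hg, fun a b => by simp [h, h']⟩ }

/-- The set of all triangulations of convex `n`-gons with labelled vertices, over all `n ≥ 3`. -/
def PolygonTriangulation : Type := Σ n : {n : ℕ // 3 ≤ n}, Triangulation n.1

/-- The sequence `(t_1, …, t_n)` of numbers of triangles at the vertices `1, …, n`. -/
noncomputable def PolygonTriangulation.triangleSeq (T : PolygonTriangulation) : List ℤ :=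
  List.ofFn fun i => (T.2.numTriangles i : ℤ)

/-!
# Weyl groupoids of rank two, `η`-sequences and triangulations

The first columns `v_0 = (1, 0), v_1, …, v_n = (-1, 0)` of the partial products of a sequence in
`𝒜⁺` satisfy `v_{k-1} + v_{k+1} = c_{k+1} v_k` and `det (v_k, v_{k+1}) = 1`: they turn
counterclockwise through the first quadrant. If no inner entry were `1`, the coordinate sums of
`v_0, …, v_{n-1}` would increase, but this sum is `1` both for `v_0` and for `v_{n-1} = (0, 1)`.
Hence there is an inner entry `1`, and removing it while lowering its neighbours by one stays in `𝒜⁺`, because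
`η(a + 1) η(1) η(b + 1) = η(a) η(b)`. So `𝒜⁺` consists of the sequences obtained from `(1, 1, 1)`
by inserting entries `1` at inner positions (`isAPlus_iff_isEarSeq`), and these are the
`η`-sequences, since `𝒜⁺` is closed under rotation and reversal.

On the side of triangulations, a shortest diagonal cuts off an ear, whose tip lies on exactly one
triangle, and cutting off the ear changes the numbers of triangles in the same way. Conversely a
vertex on exactly one triangle is the tip of an ear, so the triangulation can be recovered from its
numbers of triangles (`IsChordTriangulation.eq_of_triangleCounts_eq`). Triangulations are handled
as maximal noncrossing relations on `ℕ` containing the sides, so that deleting and inserting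
vertices is arithmetic of natural numbers.

Along a walk `a, ρ_i(a), ρ_jρ_i(a), …` in a rank two Weyl groupoid the `v_k` are the roots obtained
by pulling back the simple roots. As there are finitely many roots, some first `v_n` is negative;
then the first `n` reflections exchange positive and negative roots, so that their product is
`-1` in the frames used here, and every positive root is one of `v_0, …, v_{n-1}`
(`IsRootWalk.isAPlus`). Thus `n` is the number of positive roots, the entries are `n`-periodic,
the fourth axiom makes the walk close after `2n` steps, and simple connectedness prevents it from
closing earlier (`CartanScheme.exists_isCyclic`). Hence the scheme is a cycle of `2n` objects
labelled by the sequence, and it is determined by it; changing the starting point or the direction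
of the walk changes the sequence by a dihedral symmetry. Conversely a sequence in `𝒜⁺` labels a
cycle of length `2n`, and the vectors `v_k` form a finite root system for it because
`det (v_k, v_l) ≥ 0` for `k ≤ l ≤ k + n` (`IsQuiddity.scheme_isRootSystem`).
-/

/-! ### Products of `η`-matrices -/

/-- The product `η(c_1) ⋯ η(c_n)`. -/
def etaProd (c : List ℤ) : Matrix (Fin 2) (Fin 2) ℤ := (c.map etaMatrix).prod

@[simp] theorem etaProd_nil : etaProd [] = 1 := rfl

@[simp] theorem etaProd_cons (x : ℤ) (l : List ℤ) : etaProd (x :: l) = etaMatrix x * etaProd l := by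
  simp [etaProd]

@[simp] theorem etaProd_append (l r : List ℤ) : etaProd (l ++ r) = etaProd l * etaProd r := by
  simp [etaProd]

theorem det_etaMatrix (x : ℤ) : (etaMatrix x).det = 1 := by
  simp [etaMatrix, Matrix.det_fin_two]

theorem det_etaProd (l : List ℤ) : (etaProd l).det = 1 := by
  induction l with
  | nil => simp
  | cons x l ih => simp [Matrix.det_mul, det_etaMatrix, ih]

theorem mul_etaMatrix_zero (M : Matrix (Fin 2) (Fin 2) ℤ) (x : ℤ) (k : Fin 2) :
    (M * etaMatrix x) k 0 = x * M k 0 + M k 1 := by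
  simp [Matrix.mul_apply, etaMatrix, mul_comm]

theorem mul_etaMatrix_one (M : Matrix (Fin 2) (Fin 2) ℤ) (x : ℤ) (k : Fin 2) :
    (M * etaMatrix x) k 1 = -M k 0 := by
  simp [Matrix.mul_apply, etaMatrix]

/-- Inserting a `1` and increasing its neighbours by one does not change the product. -/
theorem etaMatrix_insert (a b : ℤ) :
    etaMatrix (a + 1) * etaMatrix 1 * etaMatrix (b + 1) = etaMatrix a * etaMatrix b := by
  ext i j
  fin_cases i <;> fin_cases j <;> simp [etaMatrix, Matrix.mul_apply]; ring

/-- Multiplying `M` by the factors `η(x)`, `x ∈ l`, one after the other, all the matrices met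
before the last multiplication have a nonnegative first column. -/
def ColsNonneg (M : Matrix (Fin 2) (Fin 2) ℤ) : List ℤ → Prop
  | [] => True
  | x :: l => (∀ k, 0 ≤ M k 0) ∧ ColsNonneg (M * etaMatrix x) l

theorem colsNonneg_append (M : Matrix (Fin 2) (Fin 2) ℤ) (l r : List ℤ) :
    ColsNonneg M (l ++ r) ↔ ColsNonneg M l ∧ ColsNonneg (M * etaProd l) r := by
  induction l generalizing M with
  | nil => simp [ColsNonneg]
  | cons x l ih => simp [ColsNonneg, ih, and_assoc, Matrix.mul_assoc]

theorem colsNonneg_iff_take (M : Matrix (Fin 2) (Fin 2) ℤ) (c : List ℤ) :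
    ColsNonneg M c ↔ ∀ i < c.length, ∀ k, 0 ≤ (M * etaProd (c.take i)) k 0 := by
  induction c generalizing M with
  | nil => simp [ColsNonneg]
  | cons x l ih =>
    simp only [ColsNonneg, ih, List.length_cons]
    constructor
    · rintro ⟨h0, h⟩ (_ | i) hi k
      · simpa using h0 k
      · simpa [Matrix.mul_assoc] using h i (by omega) k
    · intro h
      refine ⟨fun k => by simpa using h 0 (by omega) k, fun i hi k => ?_⟩
      simpa [Matrix.mul_assoc] using h (i + 1) (by omega) k

theorem isAPlus_iff (c : List ℤ) :
    IsAPlus c ↔ c ≠ [] ∧ etaProd c = -1 ∧ (∀ x ∈ c, 1 ≤ x) ∧ ColsNonneg 1 c := by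
  rw [colsNonneg_iff_take]
  simp only [Matrix.one_mul]
  exact ⟨fun h => ⟨h.1, h.2, h.3, h.4⟩, fun h => ⟨h.1, h.2.1, h.2.2.1, h.2.2.2⟩⟩

/-- The first column of a proper partial product is nonnegative. -/
theorem ColsNonneg.prefix_nonneg {M : Matrix (Fin 2) (Fin 2) ℤ} {l r : List ℤ}
    (h : ColsNonneg M (l ++ r)) (hr : r ≠ []) (k : Fin 2) : 0 ≤ (M * etaProd l) k 0 := by
  obtain ⟨x, r, rfl⟩ := List.exists_cons_of_ne_nil hr
  exact ((colsNonneg_append M l _).1 h).2.1 k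

/-! ### Stability of `𝒜⁺` under rotation, reversal and ear insertion -/

/-- `η(a)⁻¹`. -/
def etaInv (a : ℤ) : Matrix (Fin 2) (Fin 2) ℤ := !![0, 1; -1, a]

theorem etaInv_mul (a : ℤ) : etaInv a * etaMatrix a = 1 := by
  ext i j
  fin_cases i <;> fin_cases j <;> simp [etaInv, etaMatrix, Matrix.mul_apply]

theorem mul_etaInv (a : ℤ) : etaMatrix a * etaInv a = 1 := by
  ext i j
  fin_cases i <;> fin_cases j <;> simp [etaInv, etaMatrix, Matrix.mul_apply]

/-- Nonnegative vectors `v_0, v_1, …` with `det (v_k, v_{k+1}) = 1` turn counterclockwise: if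
`(a, 1)` is not strictly on the left of the first one, it is not strictly on the left of the
others. -/
theorem ColsNonneg.etaInv_mul {M : Matrix (Fin 2) (Fin 2) ℤ} {l : List ℤ} {a : ℤ}
    (hM : M.det = 1) (h0 : 0 ≤ a * M 1 0 - M 0 0) (h : ColsNonneg M l) :
    ColsNonneg (etaInv a * M) l := by
  induction l generalizing M with
  | nil => trivial
  | cons x l ih =>
    obtain ⟨hpos, hl⟩ := h
    refine ⟨?_, ?_⟩
    · intro k
      fin_cases k
      · simpa [etaInv, Matrix.mul_apply] using hpos 1
      · simp [etaInv, Matrix.mul_apply]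
        linarith
    · rw [Matrix.mul_assoc]
      cases l with
      | nil => trivial
      | cons y l =>
        refine ih ?_ ?_ hl
        · rw [Matrix.det_mul, hM, det_etaMatrix, one_mul]
        · have h1 := hl.1
          have p0 := h1 0
          have p1 := h1 1
          have q0 := hpos 0
          have q1 := hpos 1
          rw [Matrix.det_fin_two] at hM
          rw [mul_etaMatrix_zero] at p0 p1 ⊢
          rw [mul_etaMatrix_zero]
          -- `b` is the current column, `c` the next one; `(a, 1) × c` is multiplied by `b`
          by_contra hneg
          push Not at hneg
          have e0 : (a * (x * M 1 0 + M 1 1) - (x * M 0 0 + M 0 1)) * M 0 0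
              = (a * M 1 0 - M 0 0) * (x * M 0 0 + M 0 1) + a := by
            linear_combination a * hM
          have e1 : (a * (x * M 1 0 + M 1 1) - (x * M 0 0 + M 0 1)) * M 1 0
              = (a * M 1 0 - M 0 0) * (x * M 1 0 + M 1 1) + 1 := by
            linear_combination hM
          have : 0 ≤ (a * M 1 0 - M 0 0) * (x * M 1 0 + M 1 1) := mul_nonneg h0 p1
          nlinarith

theorem IsAPlus.rotate {a : ℤ} {l : List ℤ} (h : IsAPlus (a :: l)) : IsAPlus (l ++ [a]) := by
  rw [isAPlus_iff] at h ⊢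
  obtain ⟨-, hprod, hone, hcols⟩ := h
  rw [etaProd_cons] at hprod
  have hl : etaProd l = -etaInv a := by
    have := congrArg (etaInv a * ·) hprod
    simpa [← Matrix.mul_assoc, etaInv_mul] using this
  have ha : 1 ≤ a := hone a (by simp)
  refine ⟨by simp, ?_, ?_, ?_⟩
  · simp [hl, etaInv_mul]
  · intro x hx
    exact hone x (by simpa [or_comm] using hx)
  · rw [colsNonneg_append]
    refine ⟨?_, ?_⟩
    · have := ColsNonneg.etaInv_mul (a := a) (det_etaMatrix a)
        (by simp [etaMatrix]) (M := etaMatrix a) (l := l) (by simpa using hcols.2)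
      rwa [_root_.etaInv_mul] at this
    · refine ⟨?_, trivial⟩
      rw [one_mul, hl]
      intro k
      fin_cases k <;> simp [etaInv]

theorem etaProd_reverse (l : List ℤ) :
    etaProd l.reverse = !![etaProd l 0 0, -etaProd l 1 0; -etaProd l 0 1, etaProd l 1 1] := by
  induction l with
  | nil => ext i j; fin_cases i <;> fin_cases j <;> simp
  | cons x l ih =>
    rw [List.reverse_cons, etaProd_append, ih]
    ext i j
    fin_cases i <;> fin_cases j <;> simp [etaMatrix, Matrix.mul_apply] <;> ring

theorem IsAPlus.reverse {c : List ℤ} (h : IsAPlus c) : IsAPlus c.reverse := by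
  rw [isAPlus_iff] at h ⊢
  obtain ⟨hne, hprod, hone, hcols⟩ := h
  refine ⟨by simpa using hne, ?_, by simpa using hone, ?_⟩
  · rw [etaProd_reverse, hprod]
    ext i j
    fin_cases i <;> fin_cases j <;> simp
  · rw [colsNonneg_iff_take]
    intro i hi k
    rw [List.length_reverse] at hi
    rw [one_mul, List.take_reverse, etaProd_reverse]
    -- `c = l ++ [x] ++ r`, and the partial product in question belongs to the reversal of `r`
    obtain ⟨l, x, hlx⟩ : ∃ l x, c.take (c.length - i) = l ++ [x] := by
      rcases List.eq_nil_or_concat (c.take (c.length - i)) with h | ⟨l, x, h⟩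
      · have := congrArg List.length h
        rw [List.length_take, List.length_nil] at this
        omega
      · exact ⟨l, x, by simpa using h⟩
    set r := c.drop (c.length - i) with hr
    have hc : c = l ++ ([x] ++ r) := by
      rw [← List.append_assoc, ← hlx, List.take_append_drop]
    have hpre : ∀ k, 0 ≤ etaProd l k 0 := fun k => by
      have := ColsNonneg.prefix_nonneg (hc ▸ hcols) (by simp) k
      rwa [one_mul] at this
    have hL : etaProd (l ++ [x]) * etaProd r = -1 := by
      rw [← etaProd_append, List.append_assoc, ← hc, hprod]
    have hdet := det_etaProd (l ++ [x])
    have h01 : ∀ k, etaProd (l ++ [x]) k 1 = -etaProd l k 0 := fun k => by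
      rw [etaProd_append, etaProd_cons, etaProd_nil, mul_one, mul_etaMatrix_one]
    rw [Matrix.det_fin_two, h01, h01] at hdet
    have e0 := congrFun (congrFun hL 0) 0
    have e1 := congrFun (congrFun hL 1) 0
    have e2 := congrFun (congrFun hL 0) 1
    have e3 := congrFun (congrFun hL 1) 1
    simp only [Matrix.mul_apply, Fin.sum_univ_two, h01] at e0 e1 e2 e3
    simp at e0 e1 e2 e3 hdet
    have p0 := hpre 0
    have p1 := hpre 1
    fin_cases k
    · simp
      have : etaProd r 0 0 = etaProd l 1 0 := by
        linear_combination (etaProd r 0 0) * (-hdet) - etaProd l 1 0 * e0 + etaProd l 0 0 * e1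
      omega
    · simp
      have : etaProd r 0 1 = -etaProd l 0 0 := by
        linear_combination (etaProd r 0 1) * (-hdet) - etaProd l 1 0 * e2 + etaProd l 0 0 * e3
      omega

theorem IsAPlus.insert {a b : ℤ} {l : List ℤ} (h : IsAPlus (a :: b :: l)) :
    IsAPlus ((a + 1) :: 1 :: (b + 1) :: l) := by
  rw [isAPlus_iff] at h ⊢
  obtain ⟨-, hprod, hone, hcols⟩ := h
  simp only [List.mem_cons, forall_eq_or_imp] at hone
  refine ⟨by simp, ?_, ?_, ?_⟩
  · simp only [etaProd_cons, ← Matrix.mul_assoc] at hprod ⊢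
    rw [etaMatrix_insert, hprod]
  · simp only [List.mem_cons, forall_eq_or_imp]
    exact ⟨by omega, le_refl _, by omega, hone.2.2⟩
  · obtain ⟨h0, h1, h2⟩ := hcols
    refine ⟨h0, ?_, ?_, ?_⟩
    · intro k
      have := h0 k
      have := h1 k
      simp only [mul_etaMatrix_zero, add_mul] at *
      linarith
    · intro k
      have := h1 k
      simp only [mul_etaMatrix_zero, mul_etaMatrix_one] at *
      linarith
    · rwa [Matrix.mul_assoc, Matrix.mul_assoc, ← Matrix.mul_assoc (etaMatrix _), etaMatrix_insert,
        ← Matrix.mul_assoc]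

theorem IsEtaSeq.isAPlus {c : List ℤ} (h : IsEtaSeq c) : IsAPlus c := by
  induction h with
  | triangle =>
    rw [isAPlus_iff]
    refine ⟨by simp, ?_, by simp, ?_, ?_, ?_, trivial⟩
    · ext i j
      fin_cases i <;> fin_cases j <;> simp [etaMatrix, Matrix.mul_apply]
    all_goals
      rw [Fin.forall_fin_two]
      simp [etaMatrix, Matrix.mul_apply]
  | rotate a l _ ih => exact ih.rotate
  | reverse l _ ih => exact ih.reverse
  | insert a b l _ ih => exact ih.insert

/-! ### Sequences built by inserting ears, without rotations and reflections -/

/-- The sequences obtained from `(1, 1, 1)` by repeatedly inserting a `1` between two consecutive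
entries and increasing these entries by one. The last and the first entry do not count as
consecutive. -/
inductive IsEarSeq : List ℤ → Prop
  | triangle : IsEarSeq [1, 1, 1]
  | insert (l : List ℤ) (a b : ℤ) (r : List ℤ) :
      IsEarSeq (l ++ a :: b :: r) → IsEarSeq (l ++ (a + 1) :: 1 :: (b + 1) :: r)

theorem IsEtaSeq.rotate_append {l r : List ℤ} (h : IsEtaSeq (l ++ r)) : IsEtaSeq (r ++ l) := by
  induction l generalizing r with
  | nil => simpa using h
  | cons x l ih =>
    have := ih (r := r ++ [x]) (by simpa using h.rotate x (l ++ r))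
    simpa using this

theorem IsEarSeq.isEtaSeq {c : List ℤ} (h : IsEarSeq c) : IsEtaSeq c := by
  induction h with
  | triangle => exact IsEtaSeq.triangle
  | insert l a b r _ ih =>
    have h1 := IsEtaSeq.insert a b (r ++ l) (by simpa using ih.rotate_append)
    exact IsEtaSeq.rotate_append (l := (a + 1) :: 1 :: (b + 1) :: r) (r := l) (by simpa using h1)

theorem IsEarSeq.one_le {c : List ℤ} (h : IsEarSeq c) : ∀ x ∈ c, 1 ≤ x :=
  h.isEtaSeq.isAPlus.one_le

theorem IsAPlus.three_le_length {c : List ℤ} (h : IsAPlus c) : 3 ≤ c.length := by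
  have h' := (isAPlus_iff c).1 h
  obtain ⟨hne, hprod, hone, -⟩ := h'
  by_contra hlt
  match c, hne, hprod, hone, hlt with
  | [a], _, hprod, _, _ =>
    have := congrFun (congrFun hprod 1) 0
    simp [etaMatrix] at this
  | [a, b], _, hprod, hone, _ =>
    have := congrFun (congrFun hprod 0) 1
    simp [etaMatrix, Matrix.mul_apply] at this
    have := hone a (by simp)
    omega
  | _ :: _ :: _ :: _, _, _, _, hlt => exact hlt (by simp)

theorem IsAPlus.eq_of_length_eq_three {c : List ℤ} (h : IsAPlus c) (h3 : c.length = 3) :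
    c = [1, 1, 1] := by
  obtain ⟨a, b, d, rfl⟩ := List.length_eq_three.1 h3
  obtain ⟨-, hprod, hone, -⟩ := (isAPlus_iff _).1 h
  have e00 := congrFun (congrFun hprod 0) 0
  have e01 := congrFun (congrFun hprod 0) 1
  have e10 := congrFun (congrFun hprod 1) 0
  have e11 := congrFun (congrFun hprod 1) 1
  simp [etaMatrix, Matrix.mul_apply] at e00 e01 e10 e11
  have h1 : b = 1 ∧ a = 1 := by
    have ha := hone a (by simp)
    have hb := hone b (by simp)
    constructor <;> nlinarith
  have h2 : d = 1 := by
    rw [h1.1] at e10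
    omega
  rw [h1.1, h1.2, h2]

/-- If no entry is `1`, the sums of the first columns strictly increase. -/
theorem colSum_lt_of_two_le {M : Matrix (Fin 2) (Fin 2) ℤ} {l : List ℤ}
    (h0 : 0 ≤ M 0 0 + M 1 0) (h : 0 < M 0 0 + M 1 0 + (M 0 1 + M 1 1)) (hl : ∀ x ∈ l, 2 ≤ x) :
    M 0 0 + M 1 0 ≤ (M * etaProd l) 0 0 + (M * etaProd l) 1 0 := by
  induction l generalizing M with
  | nil => simp
  | cons x l ih =>
    rw [etaProd_cons, ← Matrix.mul_assoc]
    have hx : 2 ≤ x := hl x (by simp)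
    have key : M 0 0 + M 1 0 < (M * etaMatrix x) 0 0 + (M * etaMatrix x) 1 0 := by
      simp only [mul_etaMatrix_zero]
      nlinarith
    refine le_trans key.le (ih (by omega) ?_ fun y hy => hl y (by simp [hy]))
    rw [mul_etaMatrix_one, mul_etaMatrix_one]
    omega

theorem IsAPlus.exists_ear {c : List ℤ} (h : IsAPlus c) :
    ∃ l x y r, c = l ++ x :: 1 :: y :: r := by
  have h3 := h.three_le_length
  obtain ⟨-, hprod, hone, -⟩ := (isAPlus_iff _).1 h
  obtain ⟨a, c', rfl⟩ : ∃ a c', c = a :: c' := List.exists_cons_of_ne_nil h.ne_nil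
  obtain ⟨m, z, rfl⟩ : ∃ m z, c' = m ++ [z] := by
    rcases List.eq_nil_or_concat c' with h | ⟨m, z, h⟩
    · simp [h] at h3
    · exact ⟨m, z, by simpa using h⟩
  have h1 : (1 : ℤ) ∈ m := by
    by_contra hm
    have hm2 : ∀ x ∈ m, 2 ≤ x := fun x hx => by
      have := hone x (by simp [hx])
      have : x ≠ 1 := fun h => hm (h ▸ hx)
      omega
    have ha := hone a (by simp)
    have hs := colSum_lt_of_two_le (M := etaMatrix a) (l := m) (by simp [etaMatrix]; omega)
      (by simp [etaMatrix]; omega) hm2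
    have hfull : etaMatrix a * etaProd m = -etaInv z := by
      have := congrArg (· * etaInv z) hprod
      simpa [Matrix.mul_assoc, mul_etaInv] using this
    rw [hfull] at hs
    simp [etaMatrix, etaInv] at hs
    omega
  obtain ⟨s, t, rfl⟩ := List.append_of_mem h1
  obtain ⟨l, x, hl⟩ : ∃ l x, a :: s = l ++ [x] := by
    rcases List.eq_nil_or_concat (a :: s) with h | ⟨m, z, h⟩
    · simp at h
    · exact ⟨m, z, by simpa using h⟩
  obtain ⟨y, r, hr⟩ : ∃ y r, t ++ [z] = y :: r := List.exists_cons_of_ne_nil (by simp)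
  refine ⟨l, x, y, r, ?_⟩
  calc a :: (s ++ 1 :: t ++ [z]) = (a :: s) ++ 1 :: (t ++ [z]) := by simp
    _ = _ := by rw [hl, hr]; simp

/-- Two consecutive entries `1` followed by something occur only in `(1, 1, 1)`. -/
theorem IsAPlus.ne_one_left {l r : List ℤ} {x y : ℤ} (h : IsAPlus (l ++ x :: 1 :: y :: r))
    (h4 : 4 ≤ (l ++ x :: 1 :: y :: r).length) : x ≠ 1 := by
  rintro rfl
  obtain ⟨-, hprod, hone, hcols⟩ := (isAPlus_iff _).1 h
  have hcol := ColsNonneg.prefix_nonneg (M := 1) (l := l ++ [1, 1]) (r := y :: r)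
    (by simpa using hcols) (by simp)
  have hM : etaMatrix 1 * etaMatrix 1 = !![0, -1; 1, -1] := by
    ext i j
    fin_cases i <;> fin_cases j <;> simp [etaMatrix, Matrix.mul_apply]
  rcases List.eq_nil_or_concat l with rfl | ⟨l', z, hl⟩
  · obtain ⟨w, r, rfl⟩ : ∃ w r', r = w :: r' := by
      apply List.exists_cons_of_ne_nil
      rintro rfl
      simp at h4
    have := ColsNonneg.prefix_nonneg (M := 1) (l := [1, 1, y]) (r := w :: r)
      (by simpa using hcols) (by simp) 0
    simp [etaMatrix, Matrix.mul_apply] at this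
  · have hl' : l = l' ++ [z] := by simpa using hl
    subst hl'
    have hpre := ColsNonneg.prefix_nonneg (M := 1) (l := l') (r := z :: 1 :: 1 :: y :: r)
      (by simpa using hcols) (by simp)
    have e : ∀ k, etaProd (l' ++ [z] ++ [1, 1]) k 0 = -etaProd l' k 0 := fun k => by
      simp only [etaProd_append, etaProd_cons, etaProd_nil, mul_one, hM]
      rw [Matrix.mul_apply, Fin.sum_univ_two, mul_etaMatrix_one]
      simp
    have hz : ∀ k, etaProd l' k 0 = 0 := fun k => by
      have h1 := hcol k
      have h2 := hpre k
      rw [one_mul] at h1 h2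
      rw [e] at h1
      omega
    have hd := det_etaProd l'
    rw [Matrix.det_fin_two, hz, hz] at hd
    simp at hd

theorem IsAPlus.isEarSeq {c : List ℤ} (h : IsAPlus c) : IsEarSeq c := by
  generalize hn : c.length = n
  induction n using Nat.strong_induction_on generalizing c with
  | _ n ih =>
    have h3 := h.three_le_length
    by_cases h4 : c.length = 3
    · rw [h.eq_of_length_eq_three h4]
      exact IsEarSeq.triangle
    obtain ⟨l, x, y, r, rfl⟩ := h.exists_ear
    have hx := h.ne_one_left (by omega)
    have hy : y ≠ 1 := by
      have := h.reverse
      rw [show (l ++ x :: 1 :: y :: r).reverse = r.reverse ++ y :: 1 :: x :: l.reverse by simp]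
        at this
      refine this.ne_one_left ?_
      simp at h3 h4 ⊢
      omega
    obtain ⟨hne, hprod, hone, hcols⟩ := (isAPlus_iff _).1 h
    obtain ⟨x, rfl⟩ : ∃ x', x = x' + 1 := ⟨x - 1, by ring⟩
    obtain ⟨y, rfl⟩ : ∃ y', y = y' + 1 := ⟨y - 1, by ring⟩
    refine IsEarSeq.insert l x y r (ih _ ?_ ?_ rfl)
    · simp at hn ⊢
      omega
    · rw [isAPlus_iff]
      refine ⟨by simp, ?_, ?_, ?_⟩
      · rw [← hprod]
        simp only [etaProd_append, etaProd_cons]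
        rw [← Matrix.mul_assoc (etaMatrix x), ← etaMatrix_insert]
        simp only [Matrix.mul_assoc]
      · intro z hz
        simp only [List.mem_append, List.mem_cons] at hz
        have := hone (x + 1) (by simp)
        have := hone (y + 1) (by simp)
        rcases hz with hz | rfl | rfl | hz
        · exact hone z (by simp [hz])
        · omega
        · omega
        · exact hone z (by simp [hz])
      · rw [colsNonneg_append] at hcols ⊢
        obtain ⟨hl, h0, h1, h2, hr⟩ := hcols
        refine ⟨hl, h0, ?_, ?_⟩
        · intro k
          have := h2 k
          simp only [mul_etaMatrix_zero, mul_etaMatrix_one] at *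
          linarith
        · rwa [Matrix.mul_assoc, ← etaMatrix_insert, ← Matrix.mul_assoc, ← Matrix.mul_assoc]

theorem isAPlus_iff_isEarSeq (c : List ℤ) : IsAPlus c ↔ IsEarSeq c :=
  ⟨IsAPlus.isEarSeq, fun h => h.isEtaSeq.isAPlus⟩

theorem isAPlus_iff_isEtaSeq (c : List ℤ) : IsAPlus c ↔ IsEtaSeq c :=
  ⟨fun h => h.isEarSeq.isEtaSeq, IsEtaSeq.isAPlus⟩

/-! ### Triangulations as relations on `ℕ` -/

/-- A triangulation of the convex polygon with vertices `0, …, n - 1`, encoded by the relation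
`E x y` saying that `x < y` are joined by a side or by a diagonal of the triangulation: a maximal
set of pairwise noncrossing chords. The sides belong to `E` by maximality. -/
structure IsChordTriangulation (n : ℕ) (E : ℕ → ℕ → Prop) : Prop where
  lt : ∀ {a b}, E a b → a < b
  bound : ∀ {a b}, E a b → b < n
  noncrossing : ∀ {a b c d}, E a b → E c d → a < c → c < b → b < d → False
  maximal : ∀ {a b}, a < b → b < n →
    (∀ c d, E c d → ¬(a < c ∧ c < b ∧ b < d) ∧ ¬(c < a ∧ a < d ∧ d < b)) → E a b

namespace IsChordTriangulation

variable {n : ℕ} {E : ℕ → ℕ → Prop}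

theorem side (h : IsChordTriangulation n E) {a : ℕ} (ha : a + 1 < n) : E a (a + 1) :=
  h.maximal (by omega) ha fun c d _ => by omega

theorem long_side (h : IsChordTriangulation n E) (hn : 2 ≤ n) : E 0 (n - 1) :=
  h.maximal (by omega) (by omega) fun c d hcd => by
    have := h.bound hcd
    omega

/-- A triangulation of a polygon with at least four vertices cuts off an ear which is not at the
vertices `0` and `n - 1`: a shortest diagonal has length two. -/
theorem exists_ear (h : IsChordTriangulation n E) (hn : 3 ≤ n) : ∃ a, E a (a + 2) := by
  classical
  have hex : ∃ k, ∃ a, E a (a + 2 + k) :=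
    ⟨n - 3, 0, by simpa [show 0 + 2 + (n - 3) = n - 1 by omega] using h.long_side (by omega)⟩
  obtain ⟨a, ha⟩ := Nat.find_spec hex
  have hmin := fun k (hk : k < Nat.find hex) => Nat.find_min hex hk
  set k := Nat.find hex with hk
  rcases Nat.eq_zero_or_pos k with hk0 | hk0
  · exact ⟨a, by simpa [hk0] using ha⟩
  · exfalso
    have hb := h.bound ha
    refine hmin 0 hk0 ⟨a, h.maximal (by omega) (by omega)
      fun c d hcd => ⟨fun hx => ?_, fun hx => ?_⟩⟩
    · -- `c = a + 1`, and `d` lies beyond `a + 2` but not beyond the shortest diagonal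
      have hd : d ≤ a + 2 + k := by
        by_contra hlt
        exact h.noncrossing ha hcd (by omega) (by omega) (by omega)
      refine hmin (d - c - 2) (by omega) ⟨c, ?_⟩
      rwa [show c + 2 + (d - c - 2) = d by omega]
    · exact h.noncrossing hcd ha (by omega) (by omega) (by omega)

theorem eq_of_ear_right (h : IsChordTriangulation n E) {a x : ℕ} (ha : E a (a + 2))
    (hx : E x (a + 1)) : x = a := by
  have := h.lt hx
  by_contra hne
  exact h.noncrossing hx ha (by omega) (by omega) (by omega)

theorem eq_of_ear_left (h : IsChordTriangulation n E) {a y : ℕ} (ha : E a (a + 2))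
    (hy : E (a + 1) y) : y = a + 2 := by
  have := h.lt hy
  by_contra hne
  exact h.noncrossing ha hy (by omega) (by omega) (by omega)

end IsChordTriangulation

/-- The increasing enumeration of `ℕ \ {m}`. -/
def skip (m x : ℕ) : ℕ := if x < m then x else x + 1

theorem skip_lt_skip {m x y : ℕ} : skip m x < skip m y ↔ x < y := by
  unfold skip
  split_ifs <;> omega

theorem skip_injective (m : ℕ) : Function.Injective (skip m) := fun x y h => by
  unfold skip at h
  split_ifs at h <;> omega

theorem skip_ne (m x : ℕ) : skip m x ≠ m := by
  unfold skip
  split_ifs <;> omega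

theorem skip_of_lt {m x : ℕ} (h : x < m) : skip m x = x := if_pos h

theorem skip_of_le {m x : ℕ} (h : m ≤ x) : skip m x = x + 1 := if_neg (by omega)

theorem exists_skip {m x : ℕ} (h : x ≠ m) : ∃ y, x = skip m y := by
  rcases lt_or_gt_of_ne h with h | h
  · exact ⟨x, (skip_of_lt h).symm⟩
  · exact ⟨x - 1, by rw [skip_of_le (by omega)]; omega⟩

/-- Delete the vertex `m`. -/
def deleteVertex (m : ℕ) (E : ℕ → ℕ → Prop) (x y : ℕ) : Prop := E (skip m x) (skip m y)

/-- Add an ear with tip `a + 1` and base from `a` to `a + 2`, the vertices from `a + 1` on being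
shifted by one. -/
inductive InsertEar (a : ℕ) (E : ℕ → ℕ → Prop) : ℕ → ℕ → Prop
  | old {x y : ℕ} : E x y → InsertEar a E (skip (a + 1) x) (skip (a + 1) y)
  | left : InsertEar a E a (a + 1)
  | right : InsertEar a E (a + 1) (a + 2)

theorem insertEar_skip {a x y : ℕ} {E : ℕ → ℕ → Prop} :
    InsertEar a E (skip (a + 1) x) (skip (a + 1) y) ↔ E x y := by
  refine ⟨fun h => ?_, InsertEar.old⟩
  generalize hx : skip (a + 1) x = x' at h
  generalize hy : skip (a + 1) y = y' at h
  cases h with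
  | old h =>
    rwa [skip_injective _ hx, skip_injective _ hy]
  | left => exact absurd hy (skip_ne _ _)
  | right => exact absurd hx (skip_ne _ _)

theorem deleteVertex_insertEar (a : ℕ) (E : ℕ → ℕ → Prop) :
    deleteVertex (a + 1) (InsertEar a E) = E := by
  funext x y
  exact propext insertEar_skip

namespace IsChordTriangulation

variable {n : ℕ} {E : ℕ → ℕ → Prop}

theorem insertEar_deleteVertex (h : IsChordTriangulation n E) {a : ℕ} (ha : E a (a + 2)) :
    InsertEar a (deleteVertex (a + 1) E) = E := by
  have hb := h.bound ha
  funext x y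
  refine propext ⟨fun hxy => ?_, fun hxy => ?_⟩
  · cases hxy with
    | old h => exact h
    | left => exact h.side (by omega)
    | right => exact h.side hb
  · by_cases hx : x = a + 1
    · subst hx
      rw [h.eq_of_ear_left ha hxy]
      exact .right
    by_cases hy : y = a + 1
    · subst hy
      rw [h.eq_of_ear_right ha hxy]
      exact .left
    obtain ⟨x, rfl⟩ := exists_skip hx
    obtain ⟨y, rfl⟩ := exists_skip hy
    exact .old hxy

theorem deleteVertex (h : IsChordTriangulation (n + 1) E) {a : ℕ} (ha : E a (a + 2)) :
    IsChordTriangulation n (deleteVertex (a + 1) E) where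
  lt hxy := skip_lt_skip.1 (h.lt hxy)
  bound {x y} hxy := by
    have h1 := h.bound hxy
    have h2 := h.bound ha
    unfold skip at h1
    split_ifs at h1 <;> omega
  noncrossing h1 h2 l1 l2 l3 :=
    h.noncrossing h1 h2 (skip_lt_skip.2 l1) (skip_lt_skip.2 l2) (skip_lt_skip.2 l3)
  maximal {x y} hxy hy hmax := by
    refine h.maximal (skip_lt_skip.2 hxy) ?_ fun c d hcd => ?_
    · unfold skip
      split_ifs <;> omega
    · by_cases hc : c = a + 1
      · subst hc
        rw [h.eq_of_ear_left ha hcd]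
        omega
      by_cases hd : d = a + 1
      · subst hd
        rw [h.eq_of_ear_right ha hcd]
        omega
      obtain ⟨c, rfl⟩ := exists_skip hc
      obtain ⟨d, rfl⟩ := exists_skip hd
      simpa only [skip_lt_skip] using hmax c d hcd

theorem insertEar (h : IsChordTriangulation n E) {a : ℕ} (ha : a + 1 < n) :
    IsChordTriangulation (n + 1) (InsertEar a E) where
  lt hxy := by
    cases hxy with
    | old hxy => exact skip_lt_skip.2 (h.lt hxy)
    | left => omega
    | right => omega
  bound hxy := by
    cases hxy with
    | old hxy =>
      have := h.bound hxy
      unfold skip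
      split_ifs <;> omega
    | left => omega
    | right => omega
  noncrossing {x y z w} h1 h2 l1 l2 l3 := by
    cases h1 with
    | left => omega
    | right => omega
    | old h1 =>
      cases h2 with
      | left => omega
      | right => omega
      | old h2 =>
        exact h.noncrossing h1 h2 (skip_lt_skip.1 l1) (skip_lt_skip.1 l2) (skip_lt_skip.1 l3)
  maximal {x y} hxy hy hmax := by
    have hE : InsertEar a E a (a + 2) := by
      have := InsertEar.old (a := a) (h.side ha)
      rwa [skip_of_lt (by omega), skip_of_le (le_refl _)] at this
    by_cases hx : x = a + 1
    · subst hx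
      have := hmax _ _ hE
      rw [show y = a + 2 by omega]
      exact .right
    by_cases hy' : y = a + 1
    · subst hy'
      have := hmax _ _ hE
      rw [show x = a by omega]
      exact .left
    obtain ⟨x, rfl⟩ := exists_skip hx
    obtain ⟨y, rfl⟩ := exists_skip hy'
    refine .old (h.maximal (skip_lt_skip.1 hxy) ?_ fun c d hcd => ?_)
    · unfold skip at hy
      split_ifs at hy <;> omega
    · simpa only [skip_lt_skip] using hmax _ _ (.old hcd)

end IsChordTriangulation

/-! ### Numbers of triangles -/

/-- The triangles with sides in `E`. -/
def IsTriangle (E : ℕ → ℕ → Prop) (s : Finset ℕ) : Prop :=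
  ∃ x y z, E x y ∧ E y z ∧ E x z ∧ s = {x, y, z}

/-- The number of triangles at the vertex `i`. -/
noncomputable def triangleCount (E : ℕ → ℕ → Prop) (i : ℕ) : ℤ :=
  ({s | IsTriangle E s ∧ i ∈ s}.ncard : ℕ)

/-- The numbers of triangles at the vertices `0, …, n - 1`. -/
noncomputable def triangleCounts (n : ℕ) (E : ℕ → ℕ → Prop) : List ℤ :=
  (List.range n).map (triangleCount E)

theorem isTriangle_deleteVertex (m : ℕ) (E : ℕ → ℕ → Prop) (s : Finset ℕ) :
    IsTriangle (deleteVertex m E) s ↔ IsTriangle E (s.image (skip m)) := by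
  constructor
  · rintro ⟨x, y, z, h1, h2, h3, rfl⟩
    exact ⟨_, _, _, h1, h2, h3, by simp⟩
  · rintro ⟨x, y, z, h1, h2, h3, hs⟩
    have key : ∀ w ∈ ({x, y, z} : Finset ℕ), ∃ w', w = skip m w' := by
      rw [← hs]
      intro w hw
      obtain ⟨w', -, rfl⟩ := Finset.mem_image.1 hw
      exact ⟨w', rfl⟩
    obtain ⟨x, rfl⟩ := key x (by simp)
    obtain ⟨y, rfl⟩ := key y (by simp)
    obtain ⟨z, rfl⟩ := key z (by simp)
    refine ⟨x, y, z, h1, h2, h3, ?_⟩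
    apply Finset.image_injective (skip_injective m)
    simpa using hs

namespace IsChordTriangulation

variable {n : ℕ} {E : ℕ → ℕ → Prop}

theorem finite_triangles (h : IsChordTriangulation n E) (i : ℕ) :
    {s | IsTriangle E s ∧ i ∈ s}.Finite := by
  refine (Finset.finite_toSet (Finset.range n).powerset).subset ?_
  rintro s ⟨⟨x, y, z, h1, h2, h3, rfl⟩, -⟩
  rw [Finset.mem_coe, Finset.mem_powerset]
  have := h.bound h2
  have := h.bound h1
  have := h.lt h1
  have := h.lt h2
  intro w hw
  simp only [Finset.mem_insert, Finset.mem_singleton] at hw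
  rw [Finset.mem_range]
  omega

theorem isTriangle_ear (h : IsChordTriangulation n E) {a : ℕ} (ha : E a (a + 2)) :
    IsTriangle E {a, a + 1, a + 2} :=
  ⟨a, a + 1, a + 2, h.side (by have := h.bound ha; omega), h.side (h.bound ha), ha, rfl⟩

/-- The tip of an ear lies on no other triangle. -/
theorem eq_ear_of_mem (h : IsChordTriangulation n E) {a : ℕ} (ha : E a (a + 2)) {s : Finset ℕ}
    (hs : IsTriangle E s) (hm : a + 1 ∈ s) : s = {a, a + 1, a + 2} := by
  obtain ⟨x, y, z, h1, h2, h3, rfl⟩ := hs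
  have l1 := h.lt h1
  have l2 := h.lt h2
  simp only [Finset.mem_insert, Finset.mem_singleton] at hm
  rcases hm with rfl | rfl | rfl
  · have := h.eq_of_ear_left ha h1
    have := h.eq_of_ear_left ha h3
    omega
  · rw [h.eq_of_ear_right ha h1, h.eq_of_ear_left ha h2]
  · have := h.eq_of_ear_right ha h2
    have := h.eq_of_ear_right ha h3
    omega

theorem triangleCount_tip (h : IsChordTriangulation n E) {a : ℕ} (ha : E a (a + 2)) :
    triangleCount E (a + 1) = 1 := by
  have : {s | IsTriangle E s ∧ a + 1 ∈ s} = {{a, a + 1, a + 2}} := by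
    ext s
    refine ⟨fun hs => h.eq_ear_of_mem ha hs.1 hs.2, ?_⟩
    rintro rfl
    exact ⟨h.isTriangle_ear ha, by simp⟩
  rw [triangleCount, this, Set.ncard_singleton, Nat.cast_one]

/-- Cutting off an ear only removes the triangle of the ear. -/
theorem triangleCount_skip (h : IsChordTriangulation n E) {a : ℕ} (ha : E a (a + 2)) (i : ℕ) :
    triangleCount E (skip (a + 1) i) =
      triangleCount (_root_.deleteVertex (a + 1) E) i + if i = a ∨ i = a + 1 then 1 else 0 := by
  set E' := _root_.deleteVertex (a + 1) E
  have hinj : Function.Injective (Finset.image (skip (a + 1))) :=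
    Finset.image_injective (skip_injective _)
  have himage : {s | IsTriangle E s ∧ skip (a + 1) i ∈ s} \ {{a, a + 1, a + 2}} =
      Finset.image (skip (a + 1)) '' {s | IsTriangle E' s ∧ i ∈ s} := by
    ext s
    constructor
    · rintro ⟨⟨hs, hi⟩, hne⟩
      have hm : a + 1 ∉ s := fun hm => hne (h.eq_ear_of_mem ha hs hm)
      obtain ⟨t, rfl⟩ : ∃ t : Finset ℕ, t.image (skip (a + 1)) = s := by
        refine ⟨s.preimage (skip (a + 1)) (skip_injective _).injOn, ?_⟩
        ext w
        simp only [Finset.mem_image, Finset.mem_preimage]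
        constructor
        · rintro ⟨w', hw, rfl⟩
          exact hw
        · intro hw
          obtain ⟨w', rfl⟩ := exists_skip (m := a + 1) (x := w) (fun e => hm (e ▸ hw))
          exact ⟨w', hw, rfl⟩
      refine ⟨t, ⟨(isTriangle_deleteVertex _ _ _).2 hs, ?_⟩, rfl⟩
      simpa [(skip_injective (a + 1)).eq_iff] using hi
    · rintro ⟨t, ⟨ht, hi⟩, rfl⟩
      refine ⟨⟨(isTriangle_deleteVertex _ _ _).1 ht, Finset.mem_image_of_mem _ hi⟩, ?_⟩
      intro he
      have : a + 1 ∈ t.image (skip (a + 1)) := by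
        rw [Set.mem_singleton_iff.1 he]
        simp
      obtain ⟨w, -, hw⟩ := Finset.mem_image.1 this
      exact skip_ne _ _ hw
  have hcard : (({s | IsTriangle E s ∧ skip (a + 1) i ∈ s} \ {{a, a + 1, a + 2}}).ncard : ℤ) =
      triangleCount E' i := by
    rw [himage, Set.ncard_image_of_injective _ hinj]
    rfl
  rw [← hcard]
  split_ifs with hi
  · have hmem : ({a, a + 1, a + 2} : Finset ℕ) ∈ {s | IsTriangle E s ∧ skip (a + 1) i ∈ s} := by
      refine ⟨h.isTriangle_ear ha, ?_⟩
      rcases hi with rfl | rfl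
      · simp [skip_of_lt]
      · simp [skip_of_le]
    have := Set.ncard_sdiff_singleton_add_one hmem (h.finite_triangles _)
    rw [triangleCount, ← this]
    push_cast
    rfl
  · rw [Set.sdiff_singleton_eq_self, triangleCount, add_zero]
    rintro ⟨-, hmem⟩
    simp only [Finset.mem_insert, Finset.mem_singleton] at hmem
    unfold skip at hmem
    split_ifs at hmem <;> omega

theorem triangleCounts_eq_append (a k : ℕ) (E : ℕ → ℕ → Prop) :
    triangleCounts (a + 2 + k) E = (List.range a).map (triangleCount E) ++
      triangleCount E a :: triangleCount E (a + 1) ::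
        (List.range k).map fun i => triangleCount E (a + 2 + i) := by
  rw [triangleCounts, List.range_add, List.range_succ, List.range_succ]
  simp [Function.comp_def]

/-- Effect of cutting off an ear on the numbers of triangles. -/
theorem triangleCounts_ear (h : IsChordTriangulation (n + 1) E) {a : ℕ} (ha : E a (a + 2)) :
    ∃ l p q r, triangleCounts n (_root_.deleteVertex (a + 1) E) = l ++ p :: q :: r ∧
      triangleCounts (n + 1) E = l ++ (p + 1) :: 1 :: (q + 1) :: r ∧ l.length = a := by
  have hb := h.bound ha
  obtain ⟨k, rfl⟩ : ∃ k, n = a + 2 + k := ⟨n - (a + 2), by omega⟩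
  set E' := _root_.deleteVertex (a + 1) E with hE'
  have key := h.triangleCount_skip ha
  refine ⟨(List.range a).map (triangleCount E'), triangleCount E' a, triangleCount E' (a + 1),
    (List.range k).map fun i => triangleCount E' (a + 2 + i), triangleCounts_eq_append a k E',
    ?_, by simp⟩
  rw [show a + 2 + k + 1 = a + 2 + (k + 1) by omega, triangleCounts_eq_append,
    List.range_succ_eq_map]
  simp only [List.map_cons, List.map_map, Function.comp_def]
  congr 1
  · refine List.map_congr_left fun i hi => ?_
    have hi' : i < a := List.mem_range.1 hi
    have := key i
    rw [skip_of_lt (by omega), if_neg (by omega), add_zero] at this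
    exact this
  · have h0 := key a
    have h1 := key (a + 1)
    rw [skip_of_lt (by omega), if_pos (by omega)] at h0
    rw [skip_of_le (by omega), if_pos (by omega)] at h1
    rw [h0, h.triangleCount_tip ha, add_zero, h1]
    congr 3
    refine List.map_congr_left fun i _ => ?_
    have := key (a + 2 + i)
    rw [skip_of_le (by omega), if_neg (by omega), add_zero] at this
    exact this

theorem iff_of_three (h : IsChordTriangulation 3 E) (x y : ℕ) : E x y ↔ x < y ∧ y < 3 := by
  refine ⟨fun hxy => ⟨h.lt hxy, h.bound hxy⟩, fun hxy => ?_⟩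
  refine h.maximal hxy.1 hxy.2 fun c d hcd => ?_
  have := h.bound hcd
  omega

theorem triangleCounts_of_three (h : IsChordTriangulation 3 E) :
    triangleCounts 3 E = [1, 1, 1] := by
  have key : ∀ i < 3, triangleCount E i = 1 := fun i hi => by
    have : {s | IsTriangle E s ∧ i ∈ s} = {{0, 1, 2}} := by
      ext s
      simp only [IsTriangle, h.iff_of_three, Set.mem_ofPred_eq, Set.mem_singleton_iff]
      constructor
      · rintro ⟨⟨x, y, z, h1, h2, h3, rfl⟩, -⟩
        rw [show x = 0 by omega, show y = 1 by omega, show z = 2 by omega]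
      · rintro rfl
        refine ⟨⟨0, 1, 2, by omega, by omega, by omega, rfl⟩, ?_⟩
        simp
        omega
    rw [triangleCount, this, Set.ncard_singleton, Nat.cast_one]
  simp [triangleCounts, List.range_succ, key]

theorem isEarSeq (h : IsChordTriangulation n E) (hn : 3 ≤ n) : IsEarSeq (triangleCounts n E) := by
  induction n, hn using Nat.le_induction generalizing E with
  | base =>
    rw [h.triangleCounts_of_three]
    exact IsEarSeq.triangle
  | succ n hn ih =>
    obtain ⟨a, ha⟩ := h.exists_ear (by omega)
    obtain ⟨l, p, q, r, h1, h2, -⟩ := h.triangleCounts_ear ha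
    rw [h2]
    exact IsEarSeq.insert l p q r (h1 ▸ ih (h.deleteVertex ha))

theorem one_le_triangleCount (h : IsChordTriangulation n E) (hn : 3 ≤ n) {i : ℕ} (hi : i < n) :
    1 ≤ triangleCount E i :=
  (h.isEarSeq hn).one_le _ (List.mem_map_of_mem (List.mem_range.2 hi))

/-- A vertex on only one triangle is the tip of an ear. -/
theorem ear_of_triangleCount (h : IsChordTriangulation n E) (hn : 3 ≤ n) {a : ℕ} (ha : a + 2 < n)
    (h1 : triangleCount E (a + 1) = 1) : E a (a + 2) := by
  induction n, hn using Nat.le_induction generalizing E a with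
  | base =>
    rw [h.iff_of_three]
    omega
  | succ n hn ih =>
    obtain ⟨b, hb⟩ := h.exists_ear (by omega)
    by_cases hab : b = a
    · exact hab ▸ hb
    have hbn := h.bound hb
    obtain ⟨i, hi⟩ := exists_skip (m := b + 1) (x := a + 1) (by omega)
    have hin : i < n := by
      unfold skip at hi
      split_ifs at hi <;> omega
    have key := h.triangleCount_skip hb i
    have hpos := (h.deleteVertex hb).one_le_triangleCount hn hin
    rw [← hi, h1] at key
    split_ifs at key with hib
    · omega
    -- `a + 1` is not a neighbour of the tip `b + 1`, so its neighbours survive the deletion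
    have hi' : (i = a + 1 ∧ a + 1 < b) ∨ (i = a ∧ b + 1 < a) := by
      unfold skip at hi
      split_ifs at hi <;> omega
    rcases hi' with ⟨rfl, hlt⟩ | ⟨rfl, hlt⟩
    · have := ih (h.deleteVertex hb) (a := a) (by omega) (by omega)
      rwa [_root_.deleteVertex, skip_of_lt (by omega), skip_of_lt (by omega)] at this
    · obtain ⟨a, rfl⟩ : ∃ a', i = a' + 1 := ⟨i - 1, by omega⟩
      have := ih (h.deleteVertex hb) (a := a) (by omega) (by omega)
      rwa [_root_.deleteVertex, skip_of_le (by omega), skip_of_le (by omega)] at this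

/-- A triangulation is determined by its numbers of triangles. -/
theorem eq_of_triangleCounts_eq {E₁ E₂ : ℕ → ℕ → Prop} (h₁ : IsChordTriangulation n E₁)
    (h₂ : IsChordTriangulation n E₂) (hn : 3 ≤ n)
    (h : triangleCounts n E₁ = triangleCounts n E₂) : E₁ = E₂ := by
  induction n, hn using Nat.le_induction generalizing E₁ E₂ with
  | base =>
    funext x y
    rw [h₁.iff_of_three, h₂.iff_of_three]
  | succ n hn ih =>
    obtain ⟨a, ha₁⟩ := h₁.exists_ear (by omega)
    have hb := h₁.bound ha₁
    have hcount : ∀ i < n + 1, triangleCount E₁ i = triangleCount E₂ i := fun i hi => by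
      have := congrArg (·[i]?) h
      simpa [triangleCounts, hi] using this
    have ha₂ : E₂ a (a + 2) := h₂.ear_of_triangleCount (by omega) hb (by
      rw [← hcount _ (by omega), h₁.triangleCount_tip ha₁])
    rw [← h₁.insertEar_deleteVertex ha₁, ← h₂.insertEar_deleteVertex ha₂,
      ih (h₁.deleteVertex ha₁) (h₂.deleteVertex ha₂)]
    refine List.map_congr_left fun i hi => ?_
    have hi' : i < n := List.mem_range.1 hi
    have k₁ := h₁.triangleCount_skip ha₁ i
    have k₂ := h₂.triangleCount_skip ha₂ i
    rw [hcount _ (by unfold skip; split_ifs <;> omega), k₂] at k₁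
    simpa using k₁.symm

end IsChordTriangulation

theorem isChordTriangulation_three : IsChordTriangulation 3 fun x y => x < y ∧ y < 3 where
  lt h := h.1
  bound h := h.2
  noncrossing := by omega
  maximal h1 h2 _ := ⟨h1, h2⟩

theorem IsEarSeq.exists_chordTriangulation {c : List ℤ} (h : IsEarSeq c) :
    ∃ E, IsChordTriangulation c.length E ∧ triangleCounts c.length E = c := by
  induction h with
  | triangle =>
    exact ⟨_, isChordTriangulation_three, isChordTriangulation_three.triangleCounts_of_three⟩
  | insert l a b r _ ih =>
    obtain ⟨E, hE, hc⟩ := ih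
    have hlen : (l ++ (a + 1) :: 1 :: (b + 1) :: r).length = (l ++ a :: b :: r).length + 1 := by
      simp
      omega
    have hl : l.length + 1 < (l ++ a :: b :: r).length := by simp
    have hE' := hE.insertEar hl
    have hear : InsertEar l.length E l.length (l.length + 2) := by
      have := InsertEar.old (a := l.length) (hE.side hl)
      rwa [skip_of_lt (by omega), skip_of_le (le_refl _)] at this
    rw [hlen]
    refine ⟨_, hE', ?_⟩
    obtain ⟨l', p, q, r', h1, h2, h3⟩ := hE'.triangleCounts_ear hear
    rw [deleteVertex_insertEar, hc] at h1
    rw [h2]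
    obtain ⟨rfl, h4⟩ := List.append_inj h1 h3.symm
    simp only [List.cons.injEq] at h4
    obtain ⟨rfl, rfl, rfl⟩ := h4
    rfl

/-! ### Triangulations of the labelled polygon -/

theorem cycleGraph_adj_iff {n : ℕ} (hn : 3 ≤ n) (a b : Fin n) :
    (SimpleGraph.cycleGraph n).Adj a b ↔ a.val + 1 = b ∨ b.val + 1 = a ∨
      (a.val = 0 ∧ b.val + 1 = n) ∨ (b.val = 0 ∧ a.val + 1 = n) := by
  rw [SimpleGraph.cycleGraph_adj', Fin.val_sub, Fin.val_sub]
  have ha := a.isLt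
  have hb := b.isLt
  rcases lt_trichotomy a.val b.val with h | h | h
  · rw [Nat.mod_eq_of_lt (show n - b.val + a.val < n by omega),
      show n - a.val + b.val = n + (b.val - a.val) by omega, Nat.add_mod_left,
      Nat.mod_eq_of_lt (show b.val - a.val < n by omega)]
    omega
  · rw [h, show n - b.val + b.val = n by omega, Nat.mod_self]
    omega
  · rw [Nat.mod_eq_of_lt (show n - a.val + b.val < n by omega),
      show n - b.val + a.val = n + (a.val - b.val) by omega, Nat.add_mod_left,
      Nat.mod_eq_of_lt (show a.val - b.val < n by omega)]
    omega

theorem sbtw_fin_iff {n : ℕ} (a b c : Fin n) :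
    sbtw a b c ↔ (a.val < b.val ∧ b.val < c.val) ∨ (b.val < c.val ∧ c.val < a.val) ∨
      (c.val < a.val ∧ a.val < b.val) :=
  Iff.rfl

/-- In linear terms, two chords cross if their endpoints interlace. -/
theorem crossing_iff {n : ℕ} {a b c d : Fin n} (hab : a < b) (hcd : c < d) :
    Crossing a b c d ↔ (a < c ∧ c < b ∧ b < d) ∨ (c < a ∧ a < d ∧ d < b) := by
  simp only [Crossing, sbtw_fin_iff, Fin.lt_def] at *
  omega

theorem Crossing.swap_left {n : ℕ} {a b c d : Fin n} (h : Crossing a b c d) :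
    Crossing b a c d := by
  unfold Crossing at *
  tauto

theorem Crossing.swap_right {n : ℕ} {a b c d : Fin n} (h : Crossing a b c d) :
    Crossing a b d c := by
  unfold Crossing at *
  tauto

namespace Triangulation

variable {n : ℕ}

/-- The relation on `ℕ` belonging to a triangulation: `x < y` are joined by a side or by a
diagonal. -/
def chord (T : Triangulation n) (x y : ℕ) : Prop :=
  x < y ∧ ∃ (hx : x < n) (hy : y < n), (SimpleGraph.cycleGraph n ⊔ T.diag).Adj ⟨x, hx⟩ ⟨y, hy⟩

theorem chord_of_adj (T : Triangulation n) {a b : Fin n} (h : a < b)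
    (hab : (SimpleGraph.cycleGraph n ⊔ T.diag).Adj a b) : T.chord a b :=
  ⟨h, a.isLt, b.isLt, hab⟩

theorem adj_of_chord (T : Triangulation n) {a b : Fin n} (h : T.chord a b) :
    (SimpleGraph.cycleGraph n ⊔ T.diag).Adj a b :=
  h.2.2.2

theorem isChordTriangulation_chord (T : Triangulation n) (hn : 3 ≤ n) :
    IsChordTriangulation n T.chord where
  lt h := h.1
  bound h := h.2.2.1
  noncrossing {a b c d} := by
    rintro ⟨hab, ha, hb, h1⟩ ⟨hcd, hc, hd, h2⟩ l1 l2 l3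
    rw [SimpleGraph.sup_adj, cycleGraph_adj_iff hn] at h1 h2
    dsimp only at h1 h2
    have h1' : T.diag.Adj ⟨a, ha⟩ ⟨b, hb⟩ := h1.resolve_left (by omega)
    have h2' : T.diag.Adj ⟨c, hc⟩ ⟨d, hd⟩ := h2.resolve_left (by omega)
    exact T.noncrossing _ _ _ _ h1' h2'
      ((crossing_iff (Fin.mk_lt_mk.2 hab) (Fin.mk_lt_mk.2 hcd)).2 (Or.inl ⟨l1, l2, l3⟩))
  maximal {a b} hab hb hmax := by
    refine ⟨hab, hab.trans hb, hb, ?_⟩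
    rw [SimpleGraph.sup_adj]
    by_cases hside : (SimpleGraph.cycleGraph n).Adj ⟨a, hab.trans hb⟩ ⟨b, hb⟩
    · exact Or.inl hside
    refine Or.inr (T.maximal _ _ (by simp; omega) hside fun c d hcd hcross => ?_)
    have key : ∀ c d : Fin n, c < d → T.diag.Adj c d →
        ¬ Crossing ⟨a, hab.trans hb⟩ ⟨b, hb⟩ c d := by
      intro c d hlt hcd
      rw [crossing_iff (Fin.mk_lt_mk.2 hab) hlt]
      have := hmax c d (T.chord_of_adj hlt (Or.inr hcd))
      simp only [Fin.lt_def]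
      tauto
    rcases lt_or_gt_of_ne hcd.ne with hlt | hlt
    · exact key c d hlt hcd hcross
    · exact key d c hlt hcd.symm hcross.swap_right

theorem diag_adj_iff (T : Triangulation n) (a b : Fin n) :
    T.diag.Adj a b ↔ ¬ (SimpleGraph.cycleGraph n).Adj a b ∧ (T.chord a b ∨ T.chord b a) := by
  constructor
  · intro h
    refine ⟨T.not_side _ _ h, ?_⟩
    rcases lt_or_gt_of_ne h.ne with hlt | hlt
    · exact Or.inl (T.chord_of_adj hlt (Or.inr h))
    · exact Or.inr (T.chord_of_adj hlt (Or.inr h.symm))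
  · rintro ⟨hs, h | h⟩
    · exact (T.adj_of_chord h).resolve_left hs
    · exact ((T.adj_of_chord h).resolve_left fun h' => hs h'.symm).symm

theorem chord_injective : Function.Injective (chord (n := n)) := fun S T h => by
  ext a b
  rw [diag_adj_iff, diag_adj_iff, h]

/-- The triangulation with given chords. -/
def ofChord {E : ℕ → ℕ → Prop} (h : IsChordTriangulation n E) : Triangulation n where
  diag :=
    { Adj := fun a b => ¬ (SimpleGraph.cycleGraph n).Adj a b ∧ (E a b ∨ E b a)
      symm := ⟨fun a b hab => ⟨fun h' => hab.1 h'.symm, hab.2.symm⟩⟩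
      loopless := ⟨fun a ha => by
        rcases ha.2 with ha | ha <;> exact lt_irrefl _ (h.lt ha)⟩ }
  not_side a b hab := hab.1
  noncrossing := by
    have key : ∀ a b c d : Fin n, E a b → E c d → ¬ Crossing a b c d := by
      intro a b c d hab hcd
      rw [crossing_iff (Fin.lt_def.2 (h.lt hab)) (Fin.lt_def.2 (h.lt hcd))]
      rintro (⟨l1, l2, l3⟩ | ⟨l1, l2, l3⟩)
      · exact h.noncrossing hab hcd l1 l2 l3
      · exact h.noncrossing hcd hab l1 l2 l3
    rintro a b c d ⟨-, hab | hab⟩ ⟨-, hcd | hcd⟩ hcross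
    · exact key _ _ _ _ hab hcd hcross
    · exact key _ _ _ _ hab hcd hcross.swap_right
    · exact key _ _ _ _ hab hcd hcross.swap_left
    · exact key _ _ _ _ hab hcd hcross.swap_left.swap_right
  maximal := by
    intro a b hab hside hmax
    refine ⟨hside, ?_⟩
    have hn : 3 ≤ n := by
      have ha := a.isLt
      have hb := b.isLt
      have hne : a.val ≠ b.val := fun e => hab (Fin.ext e)
      by_contra hn
      obtain rfl : n = 2 := by omega
      refine hside ?_
      rw [SimpleGraph.cycleGraph_adj', Fin.val_sub, Fin.val_sub]
      have : (a.val = 0 ∧ b.val = 1) ∨ (a.val = 1 ∧ b.val = 0) := by omega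
      rcases this with ⟨h0, h1⟩ | ⟨h0, h1⟩ <;> simp [h0, h1]
    have key : ∀ a b : Fin n, a < b →
        (∀ c d, ¬ (SimpleGraph.cycleGraph n).Adj c d ∧ (E c d ∨ E d c) → ¬ Crossing a b c d) →
        E a b := by
      intro a b hlt hmax
      refine h.maximal hlt b.isLt fun c d hcd => ?_
      have hd := h.bound hcd
      have hlt' := h.lt hcd
      by_cases hs : (SimpleGraph.cycleGraph n).Adj ⟨c, hlt'.trans hd⟩ ⟨d, hd⟩
      · rw [cycleGraph_adj_iff hn] at hs
        dsimp only at hs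
        have := b.isLt
        omega
      · have := hmax ⟨c, hlt'.trans hd⟩ ⟨d, hd⟩ ⟨hs, Or.inl hcd⟩
        rw [crossing_iff hlt (Fin.mk_lt_mk.2 hlt')] at this
        simp only [Fin.lt_def] at this
        tauto
    rcases lt_or_gt_of_ne hab with hlt | hlt
    · exact Or.inl (key a b hlt hmax)
    · exact Or.inr (key b a hlt fun c d hcd hcross => hmax c d hcd hcross.swap_left)

theorem chord_ofChord {E : ℕ → ℕ → Prop} (h : IsChordTriangulation n E) (hn : 3 ≤ n) :
    (ofChord h).chord = E := by
  funext x y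
  refine propext ⟨?_, fun hxy => ?_⟩
  · rintro ⟨hlt, hx, hy, hs | hd⟩
    · rw [cycleGraph_adj_iff hn] at hs
      dsimp only at hs
      have : x + 1 = y ∨ (x = 0 ∧ y = n - 1) := by omega
      rcases this with rfl | ⟨rfl, rfl⟩
      · exact h.side hy
      · exact h.long_side (by omega)
    · exact hd.2.resolve_right fun h' => absurd (h.lt h') (by simp; omega)
  · have hlt := h.lt hxy
    have hy := h.bound hxy
    refine ⟨hlt, hlt.trans hy, hy, ?_⟩
    by_cases hs : (SimpleGraph.cycleGraph n).Adj ⟨x, hlt.trans hy⟩ ⟨y, hy⟩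
    · exact Or.inl hs
    · exact Or.inr ⟨hs, Or.inl hxy⟩

theorem isTriangle_chord_iff (T : Triangulation n) (s : Finset (Fin n)) :
    IsTriangle T.chord (s.map Fin.valEmbedding) ↔
      (SimpleGraph.cycleGraph n ⊔ T.diag).IsNClique 3 s := by
  rw [SimpleGraph.is3Clique_iff]
  constructor
  · rintro ⟨x, y, z, h1, h2, h3, hs⟩
    obtain ⟨-, hx, hy, h1⟩ := h1
    obtain ⟨-, _, hz, h2⟩ := h2
    refine ⟨⟨x, hx⟩, ⟨y, hy⟩, ⟨z, hz⟩, h1, h3.2.2.2, h2, ?_⟩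
    apply Finset.map_injective Fin.valEmbedding
    rw [hs]
    simp
  · rintro ⟨a, b, c, h1, h2, h3, rfl⟩
    have key : ∀ a b c : Fin n, a < b → b < c →
        (SimpleGraph.cycleGraph n ⊔ T.diag).Adj a b →
        (SimpleGraph.cycleGraph n ⊔ T.diag).Adj a c →
        (SimpleGraph.cycleGraph n ⊔ T.diag).Adj b c →
        IsTriangle T.chord (({a, b, c} : Finset (Fin n)).map Fin.valEmbedding) :=
      fun a b c l1 l2 h1 h2 h3 => ⟨a, b, c, T.chord_of_adj l1 h1, T.chord_of_adj l2 h3,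
        T.chord_of_adj (l1.trans l2) h2, by simp⟩
    have e1 : ({a, b, c} : Finset (Fin n)) = {a, c, b} := by ext; simp; tauto
    have e2 : ({a, b, c} : Finset (Fin n)) = {b, a, c} := by ext; simp; tauto
    have e3 : ({a, b, c} : Finset (Fin n)) = {b, c, a} := by ext; simp; tauto
    have e4 : ({a, b, c} : Finset (Fin n)) = {c, a, b} := by ext; simp; tauto
    have e5 : ({a, b, c} : Finset (Fin n)) = {c, b, a} := by ext; simp; tauto
    rcases lt_or_gt_of_ne h1.ne with l1 | l1 <;> rcases lt_or_gt_of_ne h2.ne with l2 | l2 <;>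
      rcases lt_or_gt_of_ne h3.ne with l3 | l3
    · exact key a b c l1 l3 h1 h2 h3
    · exact e1 ▸ key a c b l2 l3 h2 h1 h3.symm
    · exact absurd (l1.trans l3) (by simp [l2.le])
    · exact e4 ▸ key c a b l2 l1 h2.symm h3.symm h1
    · exact e2 ▸ key b a c l1 l2 h1.symm h3 h2
    · exact absurd (l2.trans l3) (by simp [l1.le])
    · exact e3 ▸ key b c a l3 l2 h3 h1.symm h2.symm
    · exact e5 ▸ key c b a l3 l1 h3.symm h2.symm h1.symm

theorem triangleCount_chord (T : Triangulation n) (i : Fin n) :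
    triangleCount T.chord i = T.numTriangles i := by
  rw [triangleCount, numTriangles,
    ← Set.ncard_image_of_injective _ (Finset.map_injective (Fin.valEmbedding (n := n)))]
  congr 2
  ext s
  constructor
  · rintro ⟨hs, hi⟩
    obtain ⟨t, rfl⟩ : ∃ t : Finset (Fin n), t.map Fin.valEmbedding = s := by
      obtain ⟨x, y, z, ⟨-, hx, hy, -⟩, ⟨-, -, hz, -⟩, -, rfl⟩ := hs
      exact ⟨{⟨x, hx⟩, ⟨y, hy⟩, ⟨z, hz⟩}, by simp⟩
    refine ⟨t, ⟨(T.isTriangle_chord_iff t).1 hs, ?_⟩, rfl⟩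
    obtain ⟨j, hj, hji⟩ := Finset.mem_map.1 hi
    rwa [← Fin.ext hji]
  · rintro ⟨t, ⟨ht, hi⟩, rfl⟩
    exact ⟨(T.isTriangle_chord_iff t).2 ht, Finset.mem_map_of_mem Fin.valEmbedding hi⟩

theorem triangleCounts_chord (T : Triangulation n) :
    triangleCounts n T.chord = List.ofFn fun i => (T.numTriangles i : ℤ) := by
  refine List.ext_getElem (by simp [triangleCounts]) fun i h1 h2 => ?_
  have hi : i < n := by simpa using h2
  simpa [triangleCounts] using T.triangleCount_chord ⟨i, hi⟩

theorem isAPlus (T : Triangulation n) (hn : 3 ≤ n) :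
    IsAPlus (List.ofFn fun i => (T.numTriangles i : ℤ)) := by
  rw [← triangleCounts_chord, isAPlus_iff_isEarSeq]
  exact (T.isChordTriangulation_chord hn).isEarSeq hn

theorem eq_of_numTriangles_eq (hn : 3 ≤ n) {S T : Triangulation n}
    (h : ∀ i, S.numTriangles i = T.numTriangles i) : S = T := by
  refine chord_injective ((S.isChordTriangulation_chord hn).eq_of_triangleCounts_eq
    (T.isChordTriangulation_chord hn) hn ?_)
  rw [triangleCounts_chord, triangleCounts_chord]
  simp only [h]

theorem exists_of_isAPlus (hn : 3 ≤ n) {f : Fin n → ℤ} (h : IsAPlus (List.ofFn f)) :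
    ∃ T : Triangulation n, ∀ i, (T.numTriangles i : ℤ) = f i := by
  obtain ⟨E, hE, hc⟩ := h.isEarSeq.exists_chordTriangulation
  rw [List.length_ofFn] at hE hc
  refine ⟨ofChord hE, ?_⟩
  have := triangleCounts_chord (ofChord hE)
  rw [chord_ofChord hE hn, hc] at this
  exact fun i => (congrFun (List.ofFn_injective this) i).symm

end Triangulation

/-! ### The dihedral group -/

/-- A permutation of the vertices preserving sides and crossings. -/
def IsPolygonSymm {n : ℕ} (g : Equiv.Perm (Fin n)) : Prop :=
  (∀ a b, (SimpleGraph.cycleGraph n).Adj (g a) (g b) ↔ (SimpleGraph.cycleGraph n).Adj a b) ∧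
    ∀ a b c d, Crossing (g a) (g b) (g c) (g d) ↔ Crossing a b c d

theorem val_finRotate {n : ℕ} (i : Fin n) :
    (finRotate n i).val = if i.val + 1 = n then 0 else i.val + 1 := by
  obtain ⟨m, rfl⟩ : ∃ m, n = m + 1 := ⟨n - 1, by have := i.isLt; omega⟩
  rw [coe_finRotate]
  simp [Fin.ext_iff]

theorem isPolygonSymm_finRotate {n : ℕ} (hn : 3 ≤ n) : IsPolygonSymm (finRotate n) := by
  have hs : ∀ a b c : Fin n,
      sbtw (finRotate n a) (finRotate n b) (finRotate n c) ↔ sbtw a b c := fun a b c => by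
    have := a.isLt
    have := b.isLt
    have := c.isLt
    simp only [sbtw_fin_iff, val_finRotate]
    split_ifs <;> omega
  refine ⟨fun a b => ?_, fun a b c d => by simp only [Crossing, hs]⟩
  have := a.isLt
  have := b.isLt
  have key : ∀ i : Fin n, (i.val + 1 = n ∧ (finRotate n i).val = 0) ∨
      (i.val + 1 ≠ n ∧ (finRotate n i).val = i.val + 1) := fun i => by
    rw [val_finRotate]
    split_ifs with h
    · exact Or.inl ⟨h, rfl⟩
    · exact Or.inr ⟨h, rfl⟩
  have := key a
  have := key b
  rw [cycleGraph_adj_iff hn, cycleGraph_adj_iff hn]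
  omega

theorem isPolygonSymm_revPerm {n : ℕ} (hn : 3 ≤ n) : IsPolygonSymm (Fin.revPerm (n := n)) := by
  have hs : ∀ a b c : Fin n, sbtw a.rev b.rev c.rev ↔ sbtw c b a := fun a b c => by
    have := a.isLt
    have := b.isLt
    have := c.isLt
    simp only [sbtw_fin_iff, Fin.val_rev]
    omega
  refine ⟨fun a b => ?_, fun a b c d => ?_⟩
  · have := a.isLt
    have := b.isLt
    simp only [cycleGraph_adj_iff hn, Fin.revPerm_apply, Fin.val_rev]
    omega
  · simp only [Crossing, Fin.revPerm_apply, hs]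
    tauto

theorem isPolygonSymm_of_mem {n : ℕ} (hn : 3 ≤ n) {g : Equiv.Perm (Fin n)}
    (hg : g ∈ dihedralPerms n) : IsPolygonSymm g := by
  induction hg using Subgroup.closure_induction with
  | mem g hg =>
    rcases hg with rfl | rfl
    · exact isPolygonSymm_finRotate hn
    · exact isPolygonSymm_revPerm hn
  | one => exact ⟨fun _ _ => Iff.rfl, fun _ _ _ _ => Iff.rfl⟩
  | mul g h _ _ ihg ihh =>
    exact ⟨fun a b => (ihg.1 _ _).trans (ihh.1 _ _),
      fun a b c d => (ihg.2 _ _ _ _).trans (ihh.2 _ _ _ _)⟩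
  | inv g _ ih =>
    exact ⟨fun a b => by rw [← ih.1]; simp, fun a b c d => by rw [← ih.2]; simp⟩

namespace Triangulation

variable {n : ℕ}

/-- The preimage of a triangulation under a symmetry of the polygon. -/
def comap {g : Equiv.Perm (Fin n)} (hg : IsPolygonSymm g) (T : Triangulation n) :
    Triangulation n where
  diag := T.diag.comap g
  not_side a b h h' := T.not_side _ _ h ((hg.1 a b).2 h')
  noncrossing a b c d h1 h2 h := T.noncrossing _ _ _ _ h1 h2 ((hg.2 a b c d).2 h)
  maximal a b hab hs hmax := by
    refine T.maximal _ _ (fun h => hab (g.injective h)) (fun h => hs ((hg.1 a b).1 h))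
      fun c d hcd hcross => ?_
    refine hmax (g⁻¹ c) (g⁻¹ d) (by simpa using hcd) ((hg.2 _ _ _ _).1 (by simpa using hcross))

theorem numTriangles_of_adj_iff {g : Equiv.Perm (Fin n)} (hg : IsPolygonSymm g)
    {S T : Triangulation n} (h : ∀ a b, T.diag.Adj (g a) (g b) ↔ S.diag.Adj a b) (i : Fin n) :
    S.numTriangles i = T.numTriangles (g i) := by
  have hadj : ∀ a b, (SimpleGraph.cycleGraph n ⊔ T.diag).Adj (g a) (g b) ↔
      (SimpleGraph.cycleGraph n ⊔ S.diag).Adj a b := fun a b => by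
    rw [SimpleGraph.sup_adj, SimpleGraph.sup_adj, hg.1, h]
  have hclique : ∀ s : Finset (Fin n),
      (SimpleGraph.cycleGraph n ⊔ T.diag).IsNClique 3 (s.map g.toEmbedding) ↔
        (SimpleGraph.cycleGraph n ⊔ S.diag).IsNClique 3 s := by
    intro s
    rw [SimpleGraph.is3Clique_iff, SimpleGraph.is3Clique_iff]
    constructor
    · rintro ⟨a, b, c, h1, h2, h3, hs⟩
      obtain ⟨a, rfl⟩ := g.surjective a
      obtain ⟨b, rfl⟩ := g.surjective b
      obtain ⟨c, rfl⟩ := g.surjective c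
      refine ⟨a, b, c, (hadj _ _).1 h1, (hadj _ _).1 h2, (hadj _ _).1 h3, ?_⟩
      apply Finset.map_injective g.toEmbedding
      rw [hs]
      simp
    · rintro ⟨a, b, c, h1, h2, h3, rfl⟩
      exact ⟨g a, g b, g c, (hadj _ _).2 h1, (hadj _ _).2 h2, (hadj _ _).2 h3, by simp⟩
  rw [numTriangles, numTriangles,
    ← Set.ncard_image_of_injective _ (Finset.map_injective g.toEmbedding)]
  congr 1
  ext s
  constructor
  · rintro ⟨t, ⟨ht, hi⟩, rfl⟩
    exact ⟨(hclique t).2 ht, Finset.mem_map_of_mem g.toEmbedding hi⟩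
  · rintro ⟨hs, hi⟩
    obtain ⟨t, rfl⟩ : ∃ t : Finset (Fin n), t.map g.toEmbedding = s :=
      ⟨s.map g.symm.toEmbedding, by ext; simp⟩
    exact ⟨t, ⟨(hclique t).1 hs, by simpa using hi⟩, rfl⟩

/-- Two triangulations are equivalent under the dihedral group if and only if their numbers of
triangles are. -/
theorem equiv_iff (hn : 3 ≤ n) (S T : Triangulation n) :
    S ≈ T ↔ ∃ g ∈ dihedralPerms n, ∀ i, S.numTriangles i = T.numTriangles (g i) := by
  constructor
  · rintro ⟨g, hg, h⟩
    exact ⟨g, hg, numTriangles_of_adj_iff (isPolygonSymm_of_mem hn hg) h⟩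
  · rintro ⟨g, hg, h⟩
    have hsymm := isPolygonSymm_of_mem hn hg
    refine ⟨g, hg, fun a b => ?_⟩
    have : S = T.comap hsymm := eq_of_numTriangles_eq hn fun i => by
      rw [h, numTriangles_of_adj_iff hsymm (S := T.comap hsymm) fun _ _ => Iff.rfl]
    rw [this]
    rfl

end Triangulation

/-! ### Frames of an infinite sequence -/

/-- The partial product `η(c_0) ⋯ η(c_{k-1})`. Its first column is denoted `v_k` in comments. -/
def frame (c : ℕ → ℤ) : ℕ → Matrix (Fin 2) (Fin 2) ℤ
  | 0 => 1
  | k + 1 => frame c k * etaMatrix (c k)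

/-- The determinant of the vectors `v_k` and `v_l`. -/
def frameDet (c : ℕ → ℤ) (k l : ℕ) : ℤ :=
  frame c k 0 0 * frame c l 1 0 - frame c k 1 0 * frame c l 0 0

section frame

variable (c : ℕ → ℤ)

theorem frame_eq_etaProd (k : ℕ) : frame c k = etaProd ((List.range k).map c) := by
  induction k with
  | zero => rfl
  | succ k ih => simp [frame, ih, List.range_succ]

theorem frame_add (k l : ℕ) : frame c (k + l) = frame c k * frame (fun m => c (k + m)) l := by
  induction l with
  | zero => simp [frame]
  | succ l ih => rw [← add_assoc, frame, ih, frame, Matrix.mul_assoc]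

theorem det_frame (k : ℕ) : (frame c k).det = 1 := by
  rw [frame_eq_etaProd, det_etaProd]

theorem frame_succ_one (k : ℕ) (i : Fin 2) : frame c (k + 1) i 1 = -frame c k i 0 :=
  mul_etaMatrix_one _ _ _

theorem frame_add_two (k : ℕ) (i : Fin 2) :
    frame c (k + 2) i 0 = c (k + 1) * frame c (k + 1) i 0 - frame c k i 0 := by
  rw [frame, mul_etaMatrix_zero, frame_succ_one]
  ring

theorem frameDet_succ (k : ℕ) : frameDet c k (k + 1) = 1 := by
  have := det_frame c (k + 1)
  rw [Matrix.det_fin_two, frame_succ_one, frame_succ_one] at this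
  rw [frameDet]
  linarith

theorem frame_ne_zero (k : ℕ) : ¬ ∀ i, frame c k i 0 = 0 := fun h => by
  have := frameDet_succ c k
  simp [frameDet, h] at this

variable {c}

/-- Nonnegative vectors `v_0, …, v_N` with `det (v_k, v_{k+1}) = 1` turn counterclockwise. -/
theorem frameDet_pos {N : ℕ} (h : ∀ k ≤ N, ∀ i, 0 ≤ frame c k i 0) {k l : ℕ} (hkl : k < l)
    (hl : l ≤ N) : 0 < frameDet c k l := by
  induction l, hkl using Nat.le_induction with
  | base =>
    rw [frameDet_succ]
    exact one_pos
  | succ l hkl ih =>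
    have ih := ih (by omega)
    by_contra hneg
    push Not at hneg
    have hs := frameDet_succ c l
    -- `det (v_k, v_{l+1}) v_l = det (v_k, v_l) v_{l+1} + det (v_l, v_{l+1}) v_k`
    have key : ∀ i, frameDet c k (l + 1) * frame c l i 0 =
        frameDet c k l * frame c (l + 1) i 0 + frame c k i 0 := by
      rw [Fin.forall_fin_two]
      unfold frameDet at hs ⊢
      constructor
      · linear_combination (frame c k 0 0) * hs
      · linear_combination (frame c k 1 0) * hs
    refine frame_ne_zero c k fun i => ?_
    have h1 := h k (by omega) i
    have h2 := h (l + 1) hl i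
    have h3 := h l (by omega) i
    have h4 := key i
    have h5 := mul_nonneg ih.le h2
    have h6 := mul_nonpos_of_nonpos_of_nonneg hneg h3
    omega

theorem injOn_frame {n : ℕ} (h : ∀ k < n, ∀ i, 0 ≤ frame c k i 0) :
    Set.InjOn (fun k => fun i => frame c k i 0) (Set.Iio n) := by
  have key : ∀ k l, k < l → l < n → (fun i => frame c k i 0) ≠ fun i => frame c l i 0 := by
    intro k l hkl hl he
    have hpos := frameDet_pos (N := l) (fun k hk => h k (by omega)) hkl le_rfl
    have e0 := congrFun he 0
    have e1 := congrFun he 1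
    rw [frameDet, e0, e1, mul_comm, sub_self] at hpos
    exact lt_irrefl _ hpos
  intro k hk l hl hkl
  rcases lt_trichotomy k l with hlt | heq | hlt
  · exact absurd hkl (key k l hlt hl)
  · exact heq
  · exact absurd hkl.symm (key l k hlt hk)

theorem isAPlus_map_range_iff (n : ℕ) :
    IsAPlus ((List.range n).map c) ↔ 0 < n ∧ frame c n = -1 ∧ (∀ k < n, 1 ≤ c k) ∧
      ∀ k < n, ∀ i, 0 ≤ frame c k i 0 := by
  rw [isAPlus_iff, colsNonneg_iff_take, ← frame_eq_etaProd]
  refine and_congr ?_ (and_congr Iff.rfl (and_congr ?_ ?_))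
  · simp [Nat.pos_iff_ne_zero]
  · simp
  · rw [List.length_map, List.length_range]
    refine forall₂_congr fun k hk => forall_congr' fun i => ?_
    rw [one_mul, ← List.map_take, List.take_range, min_eq_left hk.le, ← frame_eq_etaProd]

theorem frame_mulVec_single_zero (k : ℕ) :
    Matrix.mulVec (frame c k) ![1, 0] = fun i => frame c k i 0 := by
  ext i
  simp [Matrix.mulVec, dotProduct]

end frame

/-! ### Finite families of root sets give sequences in `𝒜⁺` -/

/-- The root sets met along a walk `a_0, a_1, …` in a rank two Weyl groupoid with Cartan
entries `-c_k`. The set `S k` consists of the coordinate vectors of the roots at `a_k`, the first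
coordinate belonging to the simple root of the reflection leading from `a_k` to `a_{k+1}`. -/
structure IsRootWalk (c : ℕ → ℤ) (S : ℕ → Set (Fin 2 → ℤ)) : Prop where
  one_le : ∀ k, 1 ≤ c k
  sign : ∀ k, ∀ x ∈ S k, (∀ i, 0 ≤ x i) ∨ ∀ i, x i ≤ 0
  simple_left : ∀ k z, ![z, 0] ∈ S k ↔ z = 1 ∨ z = -1
  simple_right : ∀ k z, ![0, z] ∈ S k ↔ z = 1 ∨ z = -1
  step : ∀ k y, y ∈ S (k + 1) ↔ Matrix.mulVec (etaMatrix (c k)) y ∈ S k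
  finite : ∀ k, (S k).Finite

namespace IsRootWalk

variable {c : ℕ → ℤ} {S : ℕ → Set (Fin 2 → ℤ)}

theorem mem_iff (h : IsRootWalk c S) (k : ℕ) (y : Fin 2 → ℤ) :
    y ∈ S k ↔ Matrix.mulVec (frame c k) y ∈ S 0 := by
  induction k generalizing y with
  | zero => simp [frame]
  | succ k ih => rw [h.step, ih, frame, Matrix.mulVec_mulVec]

theorem frame_mem (h : IsRootWalk c S) (k : ℕ) : (fun i => frame c k i 0) ∈ S 0 := by
  rw [← frame_mulVec_single_zero, ← h.mem_iff, h.simple_left]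
  exact Or.inl rfl

/-- As there are only finitely many roots, some `v_n` is not positive. -/
theorem exists_not_nonneg (h : IsRootWalk c S) : ∃ n, ¬ ∀ i, 0 ≤ frame c n i 0 := by
  by_contra hall
  push Not at hall
  have hinj : Function.Injective fun k => fun i => frame c k i 0 := fun k l hkl =>
    injOn_frame (n := max k l + 1) (fun k _ => hall k) (Set.mem_Iio.2 (by omega))
      (Set.mem_Iio.2 (by omega)) hkl
  exact Set.infinite_of_injective_forall_mem hinj h.frame_mem (h.finite 0)

/-- The number of positive roots is the first `n` for which `v_n` is negative, and the product of
the first `n` factors `η(c_k)` is `-1`. -/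
theorem isAPlus (h : IsRootWalk c S) :
    IsAPlus ((List.range {x ∈ S 0 | ∀ i, 0 ≤ x i}.ncard).map c) := by
  classical
  have hex := h.exists_not_nonneg
  have hn := Nat.find_spec hex
  have hmin : ∀ k < Nat.find hex, ∀ i, 0 ≤ frame c k i 0 := fun k hk =>
    not_not.1 (Nat.find_min hex hk)
  set n := Nat.find hex
  obtain ⟨m, hm⟩ : ∃ m, n = m + 1 := Nat.exists_eq_succ_of_ne_zero fun h0 => hn <| by
    rw [h0, Fin.forall_fin_two]
    simp [frame]
  have hnonpos : ∀ i, frame c n i 0 ≤ 0 := (h.sign 0 _ (h.frame_mem n)).resolve_left hn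
  have hnonpos' : ∀ i, frame c n i 1 ≤ 0 := fun i => by
    have := hmin m (by omega) i
    rw [hm, frame_succ_one]
    omega
  have hdet := det_frame c n
  rw [Matrix.det_fin_two] at hdet
  -- the preimages of the simple roots are roots, so the inverse of the frame has signed columns
  have h1 : ![frame c n 1 1, -frame c n 1 0] ∈ S n := by
    rw [h.mem_iff, show Matrix.mulVec (frame c n) ![frame c n 1 1, -frame c n 1 0] = ![1, 0] by
      ext i
      fin_cases i
      · simp [Matrix.mulVec, dotProduct]
        linarith
      · simp [Matrix.mulVec, dotProduct]
        ring]
    exact (h.simple_left 0 1).2 (Or.inl rfl)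
  have h2 : ![-frame c n 0 1, frame c n 0 0] ∈ S n := by
    rw [h.mem_iff, show Matrix.mulVec (frame c n) ![-frame c n 0 1, frame c n 0 0] = ![0, 1] by
      ext i
      fin_cases i
      · simp [Matrix.mulVec, dotProduct]
        ring
      · simp [Matrix.mulVec, dotProduct]
        linarith]
    exact (h.simple_right 0 1).2 (Or.inl rfl)
  have s1 := h.sign n _ h1
  have s2 := h.sign n _ h2
  simp [Fin.forall_fin_two] at s1 s2
  have p00 := hnonpos 0
  have p10 := hnonpos 1
  have p01 := hnonpos' 0
  have p11 := hnonpos' 1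
  have q : frame c n 1 0 = 0 ∧ frame c n 0 1 = 0 := by
    constructor
    · rcases s1 with s | s
      · have e : frame c n 1 1 = 0 := by omega
        rw [e] at hdet
        nlinarith
      · omega
    · rcases s2 with s | s
      · have e : frame c n 0 0 = 0 := by omega
        rw [e] at hdet
        nlinarith
      · omega
  rw [q.1, q.2] at hdet
  have hunit : frame c n 0 0 = -1 ∧ frame c n 1 1 = -1 := by
    have := Int.eq_one_or_neg_one_of_mul_eq_one (u := frame c n 0 0) (v := frame c n 1 1)
      (by linarith)
    rcases this with e | e
    · omega
    · rw [e] at hdet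
      exact ⟨e, by linarith⟩
  have hframe : frame c n = -1 := by
    ext i j
    fin_cases i <;> fin_cases j <;> simp [q, hunit]
  have hpos : {x ∈ S 0 | ∀ i, 0 ≤ x i} = (fun k => fun i => frame c k i 0) '' Set.Iio n := by
    ext x
    constructor
    · rintro ⟨hx, hx0⟩
      -- transport `x` along the walk up to the place where it becomes negative
      have hinv : ∀ k, ∃ y, Matrix.mulVec (frame c k) y = x := fun k =>
        ⟨Matrix.mulVec (frame c k)⁻¹ x, by
          rw [Matrix.mulVec_mulVec, Matrix.mul_nonsing_inv _ (by rw [det_frame]; exact isUnit_one),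
            Matrix.one_mulVec]⟩
      choose y hy using hinv
      have hyS : ∀ k, y k ∈ S k := fun k => by rwa [h.mem_iff, hy]
      have hne : ∀ k, y k ≠ 0 := fun k h0 => by
        have := hyS k
        rw [h0, show (0 : Fin 2 → ℤ) = ![0, 0] by ext i; fin_cases i <;> rfl,
          h.simple_left] at this
        omega
      have hy0 : y 0 = x := by simpa [frame] using hy 0
      have hex' : ∃ k, ¬ ∀ i, 0 ≤ y k i := ⟨n, fun hall => hne n <| by
        have := hy n
        rw [hframe, Matrix.neg_mulVec, Matrix.one_mulVec] at this
        ext i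
        have h3 := hall i
        have h4 := hx0 i
        rw [← this, Pi.neg_apply] at h4
        simp
        omega⟩
      have hk := Nat.find_spec hex'
      have hkmin : ∀ l < Nat.find hex', ∀ i, 0 ≤ y l i := fun l hl =>
        not_not.1 (Nat.find_min hex' hl)
      set k := Nat.find hex' with hkdef
      obtain ⟨l, hl⟩ : ∃ l, k = l + 1 := Nat.exists_eq_succ_of_ne_zero fun h0 => hk <| by
        rw [h0, hy0]
        exact hx0
      have hkn : k ≤ n := Nat.find_min' hex' fun hall => hne n <| by
        have := hy n
        rw [hframe, Matrix.neg_mulVec, Matrix.one_mulVec] at this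
        ext i
        have h3 := hall i
        have h4 := hx0 i
        rw [← this, Pi.neg_apply] at h4
        simp
        omega
      have hstep : y l = Matrix.mulVec (etaMatrix (c l)) (y (l + 1)) := by
        have e1 := hy l
        rw [← hy (l + 1), frame, ← Matrix.mulVec_mulVec] at e1
        exact Matrix.mulVec_injective_of_isUnit
          ((Matrix.isUnit_iff_isUnit_det _).2 (by rw [det_frame]; exact isUnit_one)) e1
      have hyk := (h.sign _ _ (hyS k)).resolve_left hk
      have hyl := hkmin l (by omega)
      rw [hl] at hyk
      have e1 : y l 1 = y (l + 1) 0 := by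
        rw [hstep]
        simp [etaMatrix, Matrix.mulVec, dotProduct]
      have hz : y l 1 = 0 := by
        have := hyk 0
        have := hyl 1
        omega
      have hyl' : y l = ![y l 0, 0] := by
        ext i
        fin_cases i
        · rfl
        · exact hz
      have hone := hyS l
      rw [hyl', h.simple_left] at hone
      have hone' : y l 0 = 1 := by
        have := hyl 0
        omega
      refine ⟨l, Set.mem_Iio.2 (by omega), ?_⟩
      dsimp only
      rw [← frame_mulVec_single_zero, ← hy l, hyl', hone']
    · rintro ⟨k, hk, rfl⟩
      exact ⟨h.frame_mem k, hmin k hk⟩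
  have hcard : {x ∈ S 0 | ∀ i, 0 ≤ x i}.ncard = n := by
    rw [hpos, (injOn_frame hmin).ncard_image]
    simp [← Nat.card_coe_set_eq]
  rw [hcard, isAPlus_map_range_iff]
  exact ⟨by omega, hframe, fun k _ => h.one_le k, hmin⟩

end IsRootWalk

/-! ### Walks in a rank two Weyl groupoid -/

/-- The `k`-th element of the alternating sequence `i, j, i, j, …`. -/
def alternate {I : Type u} : ℕ → I → I → I
  | 0, i, _ => i
  | k + 1, i, j => alternate k j i

theorem alternate_succ {I : Type u} (k : ℕ) (i j : I) :
    alternate (k + 1) i j = alternate k j i := rfl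

theorem alternate_two {I : Type u} (k : ℕ) (i j : I) :
    alternate (k + 2) i j = alternate k i j := rfl

theorem alternate_add {I : Type u} (k l : ℕ) (i j : I) :
    alternate (k + l) i j = alternate l (alternate k i j) (alternate k j i) := by
  induction k generalizing i j with
  | zero => simp [alternate]
  | succ k ih => rw [Nat.succ_add, alternate_succ, ih, alternate_succ, alternate_succ]

theorem alternate_ne {I : Type u} (k : ℕ) {i j : I} (hij : i ≠ j) :
    alternate k i j ≠ alternate k j i := by
  induction k generalizing i j with
  | zero => exact hij
  | succ k ih => exact ih hij.symm

theorem alternate_even {I : Type u} (k : ℕ) (i j : I) : alternate (2 * k) i j = i := by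
  induction k with
  | zero => rfl
  | succ k ih => rw [Nat.mul_succ, alternate_two, ih]

theorem alternate_add_two_mul {I : Type u} (k n : ℕ) (i j : I) :
    alternate (k + 2 * n) i j = alternate k i j := by
  rw [add_comm, alternate_add, alternate_even, alternate_even]

theorem alternate_map {I : Type u} {I' : Type*} (e : I → I') (k : ℕ) (i j : I) :
    alternate k (e i) (e j) = e (alternate k i j) := by
  induction k generalizing i j with
  | zero => rfl
  | succ k ih => exact ih j i

/-- The vector `x α_i + y α_j`. -/
noncomputable def pairVec {I : Type u} (i j : I) (y : Fin 2 → ℤ) : I →₀ ℤ :=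
  y 0 • CartanScheme.α i + y 1 • CartanScheme.α j

section pairVec

variable {I : Type u} {i j : I}

theorem pairVec_apply_left (hij : i ≠ j) (y : Fin 2 → ℤ) : pairVec i j y i = y 0 := by
  simp [pairVec, CartanScheme.α, hij.symm]

theorem pairVec_apply_right (hij : i ≠ j) (y : Fin 2 → ℤ) : pairVec i j y j = y 1 := by
  simp [pairVec, CartanScheme.α, hij]

theorem pairVec_injective (hij : i ≠ j) : Function.Injective (pairVec i j) := fun x y h => by
  have h0 := congrArg (· i) h
  have h1 := congrArg (· j) h
  simp only [pairVec_apply_left hij, pairVec_apply_right hij] at h0 h1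
  ext k
  fin_cases k
  · exact h0
  · exact h1

theorem eq_pairVec (hij : i ≠ j) (hI : ∀ k, k = i ∨ k = j) (x : I →₀ ℤ) :
    x = pairVec i j ![x i, x j] := by
  ext k
  rcases hI k with rfl | rfl
  · rw [pairVec_apply_left hij]
    rfl
  · rw [pairVec_apply_right hij]
    rfl

theorem pairVec_nonneg_iff (hij : i ≠ j) (hI : ∀ k, k = i ∨ k = j) (y : Fin 2 → ℤ) :
    (∀ k, 0 ≤ pairVec i j y k) ↔ ∀ k, 0 ≤ y k := by
  rw [Fin.forall_fin_two, ← pairVec_apply_left hij y, ← pairVec_apply_right hij y]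
  refine ⟨fun h => ⟨h i, h j⟩, fun h k => ?_⟩
  rcases hI k with rfl | rfl
  · exact h.1
  · exact h.2

end pairVec

namespace CartanScheme

variable {I : Type u} {A : Type v} (C : CartanScheme I A)

/-- The `k`-th object of the walk `a, ρ_i(a), ρ_jρ_i(a), …`, counted from zero. -/
def obj : ℕ → I → I → A → A
  | 0, _, _, a => a
  | k + 1, i, j, a => obj k j i (C.ρ i a)

/-- The `k`-th entry of the sequence `Φ(i, a)`, counted from zero. -/
def entry (k : ℕ) (i j : I) (a : A) : ℤ :=
  -C.cartan (C.obj k i j a) (alternate k i j) (alternate k j i)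

theorem entrySeq_eq (n : ℕ) (i j : I) (a : A) :
    C.entrySeq n i j a = (List.range n).map fun k => C.entry k i j a := by
  induction n generalizing i j a with
  | zero => rfl
  | succ n ih =>
    rw [entrySeq, ih, List.range_succ_eq_map, List.map_cons, List.map_map]
    rfl

theorem obj_add (k l : ℕ) (i j : I) (a : A) :
    C.obj (k + l) i j a = C.obj l (alternate k i j) (alternate k j i) (C.obj k i j a) := by
  induction k generalizing i j a with
  | zero => simp [obj, alternate]
  | succ k ih => rw [Nat.succ_add, obj, ih, alternate_succ, alternate_succ, obj]

theorem obj_succ (k : ℕ) (i j : I) (a : A) :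
    C.obj (k + 1) i j a = C.ρ (alternate k i j) (C.obj k i j a) :=
  C.obj_add k 1 i j a

theorem ρ_obj_succ (k : ℕ) (i j : I) (a : A) :
    C.ρ (alternate k i j) (C.obj (k + 1) i j a) = C.obj k i j a := by
  rw [obj_succ, C.ρ_ρ]

theorem entry_add (k l : ℕ) (i j : I) (a : A) :
    C.entry (k + l) i j a = C.entry l (alternate k i j) (alternate k j i) (C.obj k i j a) := by
  rw [entry, entry, obj_add, alternate_add, alternate_add]

theorem obj_two_mul (k : ℕ) (i j : I) (a : A) :
    C.obj (2 * k) i j a = (C.ρ j ∘ C.ρ i)^[k] a := by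
  induction k generalizing a with
  | zero => rfl
  | succ k ih =>
    rw [Nat.mul_succ, Function.iterate_succ_apply]
    exact ih _

/-- The coordinate vectors of the elements of `R` at the `k`-th object of a walk. -/
def walkRoots (R : A → Set (I →₀ ℤ)) (i j : I) (a : A) (k : ℕ) : Set (Fin 2 → ℤ) :=
  {y | pairVec (alternate k i j) (alternate k j i) y ∈ R (C.obj k i j a)}

/-- The reflection at the beginning of the edge from `b` to `ρ_i(b)` is given by an
`η`-matrix, if the roles of the two simple roots are interchanged. -/
theorem σ_pairVec (i j : I) (b : A) (y : Fin 2 → ℤ) :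
    C.σ i b (pairVec i j (Matrix.mulVec (etaMatrix (-C.cartan b i j)) y)) = pairVec j i y := by
  have h2 : C.cartan b i i = 2 := (C.isGenCartanMatrix b).diag i
  simp only [pairVec, map_add, map_zsmul, σ_α, h2]
  simp [etaMatrix, Matrix.mulVec, dotProduct]
  module

variable {C} {i j : I}

theorem cartan_neg (hirr : C.IsIrreducible) (hij : i ≠ j) (hI : ∀ k, k = i ∨ k = j) (a : A) :
    1 ≤ -C.cartan a i j := by
  have hM := C.isGenCartanMatrix a
  have hnp := hM.nonpos i j hij
  have hne : C.cartan a i j ≠ 0 := fun h0 => by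
    obtain ⟨k, hk, l, hl, h⟩ := hirr a {i} ⟨i, rfl⟩ ⟨j, hij.symm⟩
    obtain rfl : k = i := hk
    obtain rfl : l = j := (hI l).resolve_left hl
    exact h.elim (fun h => h h0) fun h => h (hM.zero_symm _ _ h0)
  omega

theorem alternate_cover (hI : ∀ k, k = i ∨ k = j) (m : ℕ) :
    ∀ k, k = alternate m i j ∨ k = alternate m j i := by
  induction m generalizing i j with
  | zero => exact hI
  | succ m ih => exact ih fun k => (hI k).symm

variable {R : A → Set (I →₀ ℤ)}

theorem IsRootSystem.sign (hR : C.IsRootSystem R) {a : A} {x : I →₀ ℤ} (hx : x ∈ R a) :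
    (∀ k, 0 ≤ x k) ∨ ∀ k, x k ≤ 0 := by
  rw [hR.pos_or_neg a] at hx
  rcases hx with hx | hx
  · exact Or.inl hx.2
  · exact Or.inr fun k => by
      have := hx.2 k
      simp at this
      exact this

theorem IsRootSystem.zsmul_mem_iff (hR : C.IsRootSystem R) (a : A) (i : I) (z : ℤ) :
    z • α i ∈ R a ↔ z = 1 ∨ z = -1 := by
  have hz : z • α i ∈ R a ↔ z • α i ∈ R a ∩ {v : I →₀ ℤ | ∃ z : ℤ, v = z • α i} :=
    ⟨fun h => ⟨h, z, rfl⟩, fun h => h.1⟩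
  rw [hz, hR.reduced]
  have key : ∀ w : ℤ, z • α i = w • α i ↔ z = w := fun w => by
    refine ⟨fun h => ?_, fun h => by rw [h]⟩
    have := congrArg (· i) h
    simpa [α] using this
  have h1 := key 1
  have h2 := key (-1)
  rw [one_smul] at h1
  rw [neg_smul, one_smul] at h2
  rw [Set.mem_insert_iff, Set.mem_singleton_iff, h1, h2]

theorem IsRootSystem.σ_mem_iff (hR : C.IsRootSystem R) (a : A) (i : I) (x : I →₀ ℤ) :
    C.σ i a x ∈ R (C.ρ i a) ↔ x ∈ R a := by
  rw [← hR.image_σ a i]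
  exact (C.σ i a).injective.mem_set_image

theorem IsRootSystem.isRootWalk (hR : C.IsRootSystem R) (hfin : ∀ a, (R a).Finite)
    (hirr : C.IsIrreducible) (hij : i ≠ j) (hI : ∀ k, k = i ∨ k = j) (a : A) :
    IsRootWalk (fun k => C.entry k i j a) (C.walkRoots R i j a) where
  one_le k := cartan_neg hirr (alternate_ne k hij) (alternate_cover hI k) _
  sign k x hx := by
    have hne := alternate_ne k hij
    refine (hR.sign hx).imp (fun h => ?_) fun h => ?_
    · exact (pairVec_nonneg_iff hne (alternate_cover hI k) x).1 h
    · rw [Fin.forall_fin_two]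
      have h0 := h (alternate k i j)
      have h1 := h (alternate k j i)
      rw [pairVec_apply_left hne] at h0
      rw [pairVec_apply_right hne] at h1
      exact ⟨h0, h1⟩
  simple_left k z := by
    rw [← hR.zsmul_mem_iff (C.obj k i j a) (alternate k i j)]
    simp [walkRoots, pairVec]
  simple_right k z := by
    rw [← hR.zsmul_mem_iff (C.obj k i j a) (alternate k j i)]
    simp [walkRoots, pairVec]
  step k y := by
    change pairVec _ _ y ∈ R _ ↔ pairVec _ _ _ ∈ R _
    rw [C.obj_succ, ← hR.σ_mem_iff (C.obj k i j a) (alternate k i j)]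
    change _ ↔ C.σ _ _ (pairVec _ _ (Matrix.mulVec (etaMatrix (-_)) y)) ∈ _
    rw [σ_pairVec]
    rfl
  finite k := (hfin _).preimage (pairVec_injective (alternate_ne k hij)).injOn

theorem planePart_eq_positivePart (hij : i ≠ j) (hI : ∀ k, k = i ∨ k = j) (S : Set (I →₀ ℤ)) :
    planePart S i j = positivePart S := by
  ext v
  constructor
  · rintro ⟨hv, p, q, rfl⟩
    have e : p • α i + q • α j = pairVec i j ![(p : ℤ), (q : ℤ)] := by simp [pairVec]
    rw [e] at hv ⊢
    exact ⟨hv, (pairVec_nonneg_iff hij hI _).2 (by simp [Fin.forall_fin_two])⟩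
  · rintro ⟨hv, hv0⟩
    refine ⟨hv, (v i).toNat, (v j).toNat, ?_⟩
    conv_lhs => rw [eq_pairVec hij hI v]
    rw [pairVec, ← natCast_zsmul, ← natCast_zsmul, Int.toNat_of_nonneg (hv0 i),
      Int.toNat_of_nonneg (hv0 j)]
    rfl

theorem planePart_eq_image (hij : i ≠ j) (hI : ∀ k, k = i ∨ k = j) (a : A) :
    planePart (R a) i j = pairVec i j '' {x ∈ C.walkRoots R i j a 0 | ∀ k, 0 ≤ x k} := by
  rw [planePart_eq_positivePart hij hI]
  ext v
  constructor
  · rintro ⟨hv, hv0⟩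
    rw [eq_pairVec hij hI v] at hv hv0 ⊢
    exact ⟨_, ⟨hv, (pairVec_nonneg_iff hij hI _).1 hv0⟩, rfl⟩
  · rintro ⟨x, ⟨hx, hx0⟩, rfl⟩
    exact ⟨hx, (pairVec_nonneg_iff hij hI x).2 hx0⟩

theorem IsRootSystem.isAPlus_entrySeq (hR : C.IsRootSystem R) (hfin : ∀ a, (R a).Finite)
    (hirr : C.IsIrreducible) (hij : i ≠ j) (hI : ∀ k, k = i ∨ k = j) (a : A) :
    IsAPlus (C.entrySeq (planePart (R a) i j).ncard i j a) := by
  rw [planePart_eq_image (C := C) hij hI, Set.ncard_image_of_injective _ (pairVec_injective hij),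
    entrySeq_eq]
  exact (hR.isRootWalk hfin hirr hij hI a).isAPlus

theorem IsRootSystem.ncard_eq (hR : C.IsRootSystem R) (hfin : ∀ a, (R a).Finite)
    (hij : i ≠ j) (hI : ∀ k, k = i ∨ k = j) (a : A) :
    (R a).ncard = 2 * (planePart (R a) i j).ncard := by
  have hneg : {v | -v ∈ positivePart (R a)} = (fun v => -v) '' positivePart (R a) := by
    ext v
    exact ⟨fun h => ⟨-v, h, by simp⟩, by rintro ⟨w, hw, rfl⟩; simpa using hw⟩
  have hpfin : (positivePart (R a)).Finite := (hfin a).subset fun v hv => hv.1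
  rw [planePart_eq_positivePart hij hI]
  conv_lhs => rw [hR.pos_or_neg a]
  rw [Set.ncard_union_eq ?_ hpfin ?_, hneg, Set.ncard_image_of_injective _ neg_injective, two_mul]
  · rw [Set.disjoint_left]
    intro v hv hv'
    have h0 : v = 0 := by
      ext k
      have h1 := hv.2 k
      have h2 := hv'.2 k
      simp at h2 ⊢
      omega
    have := (hR.zsmul_mem_iff a i 0).1 (by simpa [h0] using hv.1)
    omega
  · rw [hneg]
    exact hpfin.image _

theorem IsRootSystem.ncard_of_isMor (hR : C.IsRootSystem R) {a b : A}
    {f : (I →₀ ℤ) ≃ₗ[ℤ] (I →₀ ℤ)} (hf : C.IsMor a b f) : (R b).ncard = (R a).ncard := by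
  induction hf with
  | refl => rfl
  | step b f i _ ih => rw [← hR.image_σ, Set.ncard_image_of_injective _ (C.σ i b).injective, ih]

/-- The composition of the first `k` reflections of a walk is given by the inverse of the `k`-th
frame. -/
theorem exists_isMor_obj (C : CartanScheme I A) (k : ℕ) (i j : I) (a : A) :
    ∃ f, C.IsMor a (C.obj k i j a) f ∧ ∀ y,
      f (pairVec i j (Matrix.mulVec (frame (fun k => C.entry k i j a) k) y)) =
        pairVec (alternate k i j) (alternate k j i) y := by
  induction k with
  | zero => exact ⟨_, IsMor.refl, fun y => by simp [frame, alternate]⟩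
  | succ k ih =>
    obtain ⟨f, hf, h⟩ := ih
    rw [C.obj_succ]
    refine ⟨_, IsMor.step _ f (alternate k i j) hf, fun y => ?_⟩
    rw [LinearEquiv.trans_apply, frame, ← Matrix.mulVec_mulVec, h]
    exact C.σ_pairVec _ _ _ y

/-- In a walk that returns after an even number of steps, all the objects of the component are
met. -/
theorem exists_obj_eq_of_isMor (hI : ∀ k, k = i ∨ k = j) {n : ℕ} (hn : 0 < n) {a b : A}
    (hper : ∀ k, C.obj (k + 2 * n) i j a = C.obj k i j a) {f : (I →₀ ℤ) ≃ₗ[ℤ] (I →₀ ℤ)}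
    (hf : C.IsMor a b f) : ∃ k, C.obj k i j a = b := by
  induction hf with
  | refl => exact ⟨0, rfl⟩
  | step b f l _ ih =>
    obtain ⟨k, rfl⟩ := ih
    rcases alternate_cover hI k l with rfl | rfl
    · exact ⟨k + 1, C.obj_succ k i j a⟩
    · obtain ⟨m, hm⟩ : ∃ m, k + 2 * n = m + 1 := Nat.exists_eq_succ_of_ne_zero (by omega)
      refine ⟨m, ?_⟩
      have hd : alternate k j i = alternate m i j := by
        rw [← alternate_add_two_mul k n, hm, alternate_succ]
      rw [← hper k, hm, hd, C.ρ_obj_succ m i j a]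

/-- A Cartan scheme of rank two whose objects form a cycle of length `2n`, along which the Cartan
entries are an `n`-periodic sequence belonging to `𝒜⁺`. -/
structure IsCyclic (C : CartanScheme I A) (n : ℕ) : Prop where
  isAPlus : ∀ i j a, i ≠ j → IsAPlus (C.entrySeq n i j a)
  entry_add : ∀ i j a, i ≠ j → ∀ k, C.entry (k + n) i j a = C.entry k i j a
  obj_eq_iff : ∀ i j a, i ≠ j → ∀ k l, C.obj k i j a = C.obj l i j a ↔ k ≡ l [MOD 2 * n]
  exists_obj : ∀ i j a, i ≠ j → ∀ b, ∃ k, C.obj k i j a = b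

theorem eq_or_eq_of_card_eq_two (hI : Nat.card I = 2) (hij : i ≠ j) (k : I) : k = i ∨ k = j := by
  obtain ⟨p, q, -, hpq⟩ := Nat.card_eq_two_iff.1 hI
  have hmem : ∀ l, l = p ∨ l = q := fun l => by
    have : l ∈ ({p, q} : Set I) := hpq ▸ Set.mem_univ l
    simpa using this
  rcases hmem i with rfl | rfl <;> rcases hmem j with rfl | rfl
  · exact absurd rfl hij
  · exact hmem k
  · exact (hmem k).symm
  · exact absurd rfl hij

theorem exists_isCyclic {C : CartanScheme I A} (hI : Nat.card I = 2) (hconn : C.IsConnected)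
    (hsc : C.IsSimplyConnected) (hirr : C.IsIrreducible) (hfin : C.HasFiniteRootSystem) :
    ∃ n, C.IsCyclic n := by
  obtain ⟨R, hR, hfin⟩ := hfin
  have hcover : ∀ {i j : I}, i ≠ j → ∀ k, k = i ∨ k = j := eq_or_eq_of_card_eq_two hI
  obtain ⟨a₀⟩ := C.nonempty
  -- the number of positive roots does not depend on the object
  have hcard : ∀ {i j : I} (_ : i ≠ j) (a : A),
      (planePart (R a) i j).ncard = (R a₀).ncard / 2 := fun {i j} hij a => by
    obtain ⟨f, hf⟩ := hconn a₀ a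
    rw [← hR.ncard_of_isMor hf, hR.ncard_eq hfin hij (hcover hij) a]
    omega
  set n := (R a₀).ncard / 2
  have hA : ∀ i j a, i ≠ j → IsAPlus (C.entrySeq n i j a) := fun i j a hij => by
    rw [← hcard hij a]
    exact hR.isAPlus_entrySeq hfin hirr hij (hcover hij) a
  have hA' := fun i j a hij => (isAPlus_map_range_iff n).1 (C.entrySeq_eq n i j a ▸ hA i j a hij)
  have hper : ∀ i j a, i ≠ j → C.obj (2 * n) i j a = a := fun i j a hij => by
    have := hR.iterate_ρ a j i hij.symm ((hfin a).subset fun v hv => hv.1)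
    rwa [hcard hij.symm, ← obj_two_mul] at this
  have hentry : ∀ i j a, i ≠ j → C.entry n i j a = C.entry 0 i j a := fun i j a hij => by
    have h0 := (hA' i j a hij).2.1
    have h1 := (hA' j i (C.ρ i a) hij.symm).2.1
    have hs := frame_add (fun k => C.entry k i j a) 1 n
    rw [add_comm 1 n, frame, h0] at hs
    have hc : (fun m => C.entry (1 + m) i j a) = fun m => C.entry m j i (C.ρ i a) := by
      funext m
      rw [C.entry_add]
      rfl
    rw [hc, h1] at hs
    have := congrFun (congrFun hs 0) 0
    simpa [frame, etaMatrix] using this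
  have hentry' : ∀ i j a, i ≠ j → ∀ k, C.entry (k + n) i j a = C.entry k i j a :=
    fun i j a hij k => by
      rw [C.entry_add, hentry _ _ _ (alternate_ne k hij), ← C.entry_add, add_zero]
  have hne : ∀ i j a, i ≠ j → ∀ d, 0 < d → d < 2 * n → C.obj d i j a ≠ a := by
    intro i j a hij d hd0 hd he
    obtain ⟨f, hf, h⟩ := C.exists_isMor_obj d i j a
    rw [he] at hf
    have hf1 : f = LinearEquiv.refl ℤ _ := congrArg Subtype.val (hsc a ⟨f, hf⟩)
    set c := fun k => C.entry k i j a
    obtain ⟨-, hprod, -, hcol⟩ := hA' i j a hij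
    -- a trivial endomorphism forces the columns of the frame to be nonnegative
    have hnn : ∀ y : Fin 2 → ℤ, (∀ k, 0 ≤ y k) → ∀ k, 0 ≤ Matrix.mulVec (frame c d) y k := by
      intro y hy
      rw [← pairVec_nonneg_iff hij (hcover hij)]
      have := h y
      rw [hf1, LinearEquiv.refl_apply] at this
      rw [this, pairVec_nonneg_iff (alternate_ne d hij) (alternate_cover (hcover hij) d)]
      exact hy
    rcases le_or_gt d n with hdn | hdn
    · obtain ⟨m, rfl⟩ : ∃ m, d = m + 1 := Nat.exists_eq_succ_of_ne_zero (by omega)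
      refine frame_ne_zero c m fun k => ?_
      have h1 := hnn ![0, 1] (by simp [Fin.forall_fin_two]) k
      have h2 : 0 ≤ frame c m k 0 := hcol m (by omega) k
      have h3 : Matrix.mulVec (frame c (m + 1)) ![0, 1] k = -frame c m k 0 := by
        rw [← frame_succ_one]
        simp [Matrix.mulVec, dotProduct]
      omega
    · obtain ⟨r, rfl⟩ : ∃ r, d = n + r := ⟨d - n, by omega⟩
      refine frame_ne_zero c r fun k => ?_
      have h1 := hnn ![1, 0] (by simp [Fin.forall_fin_two]) k
      have h2 : 0 ≤ frame c r k 0 := hcol r (by omega) k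
      have hc : (fun m => c (n + m)) = c := by
        funext m
        rw [add_comm]
        exact hentry' i j a hij m
      rw [frame_mulVec_single_zero, frame_add, hprod, hc, neg_one_mul] at h1
      change 0 ≤ -frame c r k 0 at h1
      omega
  have hobj : ∀ i j a, i ≠ j → ∀ k, C.obj (k + 2 * n) i j a = C.obj k i j a :=
    fun i j a hij k => by rw [C.obj_add, hper _ _ _ (alternate_ne k hij)]
  have hpos : 0 < n := by
    obtain ⟨i, j, hij, -⟩ := Nat.card_eq_two_iff.1 hI
    exact (hA' i j a₀ hij).1
  refine ⟨n, hA, hentry', fun i j a hij k l => ?_, fun i j a hij b => ?_⟩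
  · have hmod : ∀ k, C.obj (k % (2 * n)) i j a = C.obj k i j a :=
      Function.Periodic.map_mod_nat (f := fun k => C.obj k i j a) (hobj i j a hij)
    have hlt : ∀ k l, k < l → l < 2 * n → C.obj k i j a ≠ C.obj l i j a := by
      intro k l hkl hl he
      obtain ⟨d, rfl⟩ : ∃ d, l = k + d := ⟨l - k, by omega⟩
      rw [C.obj_add] at he
      exact hne _ _ _ (alternate_ne k hij) d (by omega) (by omega) he.symm
    have hk := Nat.mod_lt k (show 0 < 2 * n by omega)
    have hl := Nat.mod_lt l (show 0 < 2 * n by omega)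
    rw [← hmod k, ← hmod l]
    refine ⟨fun h => ?_, fun h => by rw [h]⟩
    by_contra hkl
    rcases lt_or_gt_of_ne hkl with hlt' | hlt'
    · exact hlt _ _ hlt' hl h
    · exact hlt _ _ hlt' hk h.symm
  · obtain ⟨f, hf⟩ := hconn a b
    exact exists_obj_eq_of_isMor (hcover hij) hpos (hobj i j a hij) hf

theorem IsCyclic.card_objects {n : ℕ} (h : C.IsCyclic n) (hij : i ≠ j) : Nat.card A = 2 * n := by
  obtain ⟨a⟩ := C.nonempty
  have hn := (h.isAPlus i j a hij).three_le_length
  rw [entrySeq_eq, List.length_map, List.length_range] at hn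
  have hbij : Function.Bijective fun k : Fin (2 * n) => C.obj k i j a := by
    constructor
    · intro k l hkl
      have := (h.obj_eq_iff i j a hij k l).1 hkl
      rw [Nat.ModEq, Nat.mod_eq_of_lt k.isLt, Nat.mod_eq_of_lt l.isLt] at this
      exact Fin.ext this
    · intro b
      obtain ⟨k, rfl⟩ := h.exists_obj i j a hij b
      exact ⟨⟨k % (2 * n), Nat.mod_lt _ (by omega)⟩,
        (h.obj_eq_iff i j a hij _ _).2 (Nat.mod_modEq k _)⟩
  rw [← Nat.card_eq_of_bijective _ hbij, Nat.card_fin]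

theorem IsCyclic.three_le {n : ℕ} (h : C.IsCyclic n) (hij : i ≠ j) : 3 ≤ n := by
  obtain ⟨a⟩ := C.nonempty
  have hn := (h.isAPlus i j a hij).three_le_length
  rwa [entrySeq_eq, List.length_map, List.length_range] at hn

end CartanScheme

/-! ### The Cartan scheme of a sequence in `𝒜⁺` -/

/-- The `n`-periodic continuation of a sequence in `𝒜⁺` of length `n`. -/
structure IsQuiddity (n : ℕ) (c : ℕ → ℤ) : Prop where
  periodic : ∀ k, c (k + n) = c k
  isAPlus : IsAPlus ((List.range n).map c)

namespace IsQuiddity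

variable {n : ℕ} {c : ℕ → ℤ}

theorem pos (h : IsQuiddity n c) : 0 < n := ((isAPlus_map_range_iff n).1 h.isAPlus).1

theorem frame_add (h : IsQuiddity n c) (k : ℕ) : frame c (k + n) = -frame c k := by
  have hc : (fun m => c (n + m)) = c := by
    funext m
    rw [add_comm, h.periodic]
  rw [add_comm, _root_.frame_add, ((isAPlus_map_range_iff n).1 h.isAPlus).2.1, hc, neg_one_mul]

theorem frame_periodic (h : IsQuiddity n c) : Function.Periodic (frame c) (2 * n) := fun k => by
  rw [two_mul, ← add_assoc, h.frame_add, h.frame_add, neg_neg]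

theorem one_le (h : IsQuiddity n c) (k : ℕ) : 1 ≤ c k := by
  have hmod : c (k % n) = c k := Function.Periodic.map_mod_nat h.periodic k
  rw [← hmod]
  exact ((isAPlus_map_range_iff n).1 h.isAPlus).2.2.1 _ (Nat.mod_lt _ h.pos)

theorem frameDet_add_right (h : IsQuiddity n c) (k l : ℕ) :
    frameDet c k (l + n) = -frameDet c k l := by
  simp [frameDet, h.frame_add]
  ring

theorem frameDet_add_left (h : IsQuiddity n c) (k l : ℕ) :
    frameDet c (k + n) l = -frameDet c k l := by
  simp [frameDet, h.frame_add]
  ring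

/-- The entries of a frieze pattern are positive. -/
theorem frameDet_pos (h : IsQuiddity n c) {k l : ℕ} (hkl : k < l) (hl : l < k + n) :
    0 < frameDet c k l := by
  induction k using Nat.strong_induction_on generalizing l with
  | _ k ih =>
    have hpos := h.pos
    have hcol := ((isAPlus_map_range_iff n).1 h.isAPlus).2.2.2
    have base : ∀ {k l : ℕ}, k < l → l < n → 0 < frameDet c k l := fun {k l} hkl hl =>
      _root_.frameDet_pos (N := n - 1) (fun k hk => hcol k (by omega)) hkl (by omega)
    rcases lt_or_ge k n with hk | hk
    · rcases lt_or_ge l n with hln | hln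
      · exact base hkl hln
      · obtain ⟨m, rfl⟩ : ∃ m, l = m + n := ⟨l - n, by omega⟩
        have := base (k := m) (l := k) (by omega) hk
        rw [h.frameDet_add_right]
        rw [frameDet] at this ⊢
        linarith
    · obtain ⟨k, rfl⟩ : ∃ k', k = k' + n := ⟨k - n, by omega⟩
      obtain ⟨l, rfl⟩ : ∃ l', l = l' + n := ⟨l - n, by omega⟩
      rw [h.frameDet_add_right, h.frameDet_add_left, neg_neg]
      exact ih k (by omega) (by omega) (by omega)

theorem frameDet_nonneg (h : IsQuiddity n c) {k l : ℕ} (hkl : k ≤ l) (hl : l ≤ k + n) :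
    0 ≤ frameDet c k l := by
  have self : ∀ k, frameDet c k k = 0 := fun k => by
    rw [frameDet]
    ring
  rcases hkl.eq_or_lt with rfl | hkl
  · rw [self]
  rcases hl.eq_or_lt with rfl | hl
  · rw [h.frameDet_add_right, self, neg_zero]
  · exact (h.frameDet_pos hkl hl).le

end IsQuiddity

/-- The objects of the Cartan scheme of a sequence of length `n`: the elements of `ℤ/2n`. -/
abbrev CycleObj (n : ℕ) : Type v := ULift.{v} (ZMod (2 * n))

/-- The index set of the Cartan scheme of a sequence: the elements of `ℤ/2`. -/
abbrev ParityIndex : Type u := ULift.{u} (ZMod 2)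

/-- The parity of an element of `ℤ/2n`. -/
def parity {n : ℕ} (a : CycleObj.{v} n) : ParityIndex.{u} :=
  ⟨ZMod.castHom (Dvd.intro n rfl : 2 ∣ 2 * n) (ZMod 2) a.down⟩

section parity

variable {n : ℕ}

theorem parity_add_one (a : CycleObj.{v} n) : parity.{u} (a + 1) = parity a + 1 := by
  apply ULift.ext
  simp [parity]

theorem eq_add_one_of_ne {i j : ParityIndex.{u}} (h : i ≠ j) : i = j + 1 := by
  have key : ∀ x y : ZMod 2, x ≠ y → x = y + 1 := by decide
  exact ULift.ext _ _ (key _ _ fun h' => h (ULift.ext _ _ h'))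

theorem add_one_ne (i : ParityIndex.{u}) : i + 1 ≠ i := by
  have key : ∀ x : ZMod 2, x + 1 ≠ x := by decide
  exact fun h => key i.down (congrArg ULift.down h)

theorem add_one_add_one (i : ParityIndex.{u}) : i + 1 + 1 = i := by
  have key : ∀ x : ZMod 2, x + 1 + 1 = x := by decide
  exact ULift.ext _ _ (key i.down)

theorem parity_sub_one (a : CycleObj.{v} n) : parity.{u} (a - 1) = parity a + 1 := by
  have := parity_add_one.{u} (a - 1)
  rw [sub_add_cancel] at this
  rw [this, add_one_add_one]

theorem parity_cover (i : ParityIndex.{u}) : ∀ k, k = i ∨ k = i + 1 := fun k => by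
  by_cases h : k = i
  · exact Or.inl h
  · exact Or.inr (eq_add_one_of_ne h)

theorem cover_of_ne {i j : ParityIndex.{u}} (h : i ≠ j) : ∀ k, k = i ∨ k = j := fun k => by
  rw [eq_add_one_of_ne h.symm]
  exact parity_cover i k

/-- The function on `ℤ/2n` given by a `2n`-periodic function. -/
def descend {X : Type*} (f : ℕ → X) (a : CycleObj.{v} n) : X := f a.down.val

theorem descend_natCast {X : Type*} {f : ℕ → X} (hf : Function.Periodic f (2 * n)) (k : ℕ) :
    descend f (k : CycleObj.{v} n) = f k := by
  rw [descend, ULift.down_natCast, ZMod.val_natCast, hf.map_mod_nat]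

theorem exists_natCast_eq (hn : 0 < n) (a : CycleObj.{v} n) (m : ℕ) :
    ∃ k, m ≤ k ∧ a = (k : ℕ) := by
  have : NeZero (2 * n) := ⟨by omega⟩
  refine ⟨a.down.val + m * (2 * n), ?_, ?_⟩
  · have := Nat.le_mul_of_pos_right m (show 0 < 2 * n by omega)
    omega
  · apply ULift.ext
    rw [ULift.down_natCast, Nat.cast_add, ZMod.natCast_zmod_val, Nat.cast_mul, ZMod.natCast_self,
      mul_zero, add_zero]

theorem natCast_two_mul_self : ((2 * n : ℕ) : CycleObj.{v} n) = 0 := by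
  apply ULift.ext
  rw [ULift.down_natCast, ZMod.natCast_self]
  rfl

end parity

namespace IsQuiddity

open CartanScheme

variable {n : ℕ} {c : ℕ → ℤ}

theorem periodic_two_mul (h : IsQuiddity n c) : Function.Periodic c (2 * n) := fun k => by
  rw [two_mul, ← add_assoc, h.periodic, h.periodic]

open Classical in
/-- The Cartan scheme of a sequence: the objects are arranged in a cycle of length `2n`, and the
edges from `a` to `a + 1` belong alternately to the two elements of the index set and are labelled
by the entries of the sequence. -/
noncomputable def scheme (h : IsQuiddity n c) : CartanScheme ParityIndex.{u} (CycleObj.{v} n) where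
  nonempty := ⟨0⟩
  ρ i a := if i = parity a then a + 1 else a - 1
  cartan a i j :=
    if i = j then 2 else if i = parity a then -descend c a else -descend c (a - 1)
  isGenCartanMatrix a :=
    have key : ∀ b : CycleObj.{v} n, 1 ≤ descend c b := fun b => h.one_le _
    { diag := fun i => if_pos rfl
      nonpos := fun i j hij => by
        have h1 := key a
        have h2 := key (a - 1)
        rw [if_neg hij]
        split_ifs <;> omega
      zero_symm := fun i j h0 => by
        have h1 := key a
        have h2 := key (a - 1)
        split_ifs at h0 <;> omega }
  ρ_ρ i a := by
    by_cases hi : i = parity a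
    · rw [if_pos hi, parity_add_one, if_neg (hi ▸ (add_one_ne i).symm), add_sub_cancel_right]
    · rw [if_neg hi, parity_sub_one, if_pos (eq_add_one_of_ne hi), sub_add_cancel]
  cartan_ρ i j a := by
    by_cases hi : i = parity a
    · simp only [if_pos hi, parity_add_one, if_neg (hi ▸ (add_one_ne i).symm : i ≠ parity a + 1),
        add_sub_cancel_right]
    · simp only [if_neg hi, parity_sub_one, if_pos (eq_add_one_of_ne hi)]

variable (h : IsQuiddity n c)

theorem scheme_ρ_parity (a : CycleObj.{v} n) :
    (h.scheme.{u, v}).ρ (parity a) a = a + 1 := if_pos rfl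

theorem scheme_ρ_parity_add_one (a : CycleObj.{v} n) :
    (h.scheme.{u, v}).ρ (parity a + 1) a = a - 1 := if_neg (add_one_ne _)

theorem scheme_cartan_parity (a : CycleObj.{v} n) :
    (h.scheme.{u, v}).cartan a (parity a) (parity a + 1) = -descend c a :=
  (if_neg (add_one_ne _).symm).trans (if_pos rfl)

theorem scheme_cartan_parity_add_one (a : CycleObj.{v} n) :
    (h.scheme.{u, v}).cartan a (parity a + 1) (parity a) = -descend c (a - 1) :=
  (if_neg (add_one_ne _)).trans (if_neg (add_one_ne _))

theorem scheme_obj_forward (k : ℕ) (a : CycleObj.{v} n) :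
    (h.scheme.{u, v}).obj k (parity a) (parity a + 1) a = a + k := by
  induction k generalizing a with
  | zero => simp [obj]
  | succ k ih =>
    have := ih (a + 1)
    rw [parity_add_one, add_one_add_one] at this
    rw [obj, scheme_ρ_parity, this]
    push_cast
    ring

theorem scheme_obj_backward (k : ℕ) (a : CycleObj.{v} n) :
    (h.scheme.{u, v}).obj k (parity a + 1) (parity a) a = a - k := by
  induction k generalizing a with
  | zero => simp [obj]
  | succ k ih =>
    have := ih (a - 1)
    rw [parity_sub_one, add_one_add_one] at this
    rw [obj, scheme_ρ_parity_add_one, this]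
    push_cast
    ring

theorem parity_natCast (k : ℕ) :
    parity.{u} (k : CycleObj.{v} n) = alternate k 0 1 ∧
      parity.{u} (k : CycleObj.{v} n) + 1 = alternate k 1 0 := by
  have e0 : (0 : ParityIndex.{u}) + 1 = 1 := zero_add 1
  induction k with
  | zero =>
    have : parity.{u} ((0 : ℕ) : CycleObj.{v} n) = 0 := by
      apply ULift.ext
      simp [parity]
    rw [this]
    exact ⟨rfl, e0⟩
  | succ k ih =>
    rw [Nat.cast_succ, parity_add_one, add_one_add_one]
    exact ⟨ih.2, ih.1⟩

theorem scheme_entrySeq :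
    (h.scheme.{u, v}).entrySeq n 0 1 0 = (List.range n).map c := by
  rw [entrySeq_eq]
  refine List.map_congr_left fun k _ => ?_
  obtain ⟨p0, p1⟩ := parity_natCast.{u, v} (n := n) 0
  obtain ⟨h0, h1⟩ := parity_natCast.{u, v} (n := n) k
  have hobj := h.scheme_obj_forward.{u, v} k ((0 : ℕ) : CycleObj.{v} n)
  rw [p1, p0, Nat.cast_zero, zero_add] at hobj
  change -(h.scheme.{u, v}).cartan ((h.scheme.{u, v}).obj k 0 1 0) _ _ = _
  change (h.scheme.{u, v}).obj k 0 1 0 = k at hobj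
  rw [hobj, ← h0, ← h1, scheme_cartan_parity, neg_neg, descend_natCast h.periodic_two_mul]

/-- The vector `v_a` belonging to an object `a`: the first column of a frame. -/
def vec (_h : IsQuiddity n c) (a : CycleObj.{v} n) (i : Fin 2) : ℤ := descend (frame c) a i 0

/-- The frame at `a`: the linear map to the plane which sends the simple root of the reflection
`a → a + 1` to `v_a` and the other simple root to `-v_{a-1}`. -/
def toPlane (a : CycleObj.{v} n) (x : ParityIndex.{u} →₀ ℤ) (i : Fin 2) : ℤ :=
  x (parity a) * h.vec a i - x (parity a + 1) * h.vec (a - 1) i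

/-- The determinant of two vectors of the plane. -/
def cross (x y : Fin 2 → ℤ) : ℤ := x 0 * y 1 - x 1 * y 0

theorem vec_natCast (k : ℕ) (i : Fin 2) : h.vec (k : CycleObj.{v} n) i = frame c k i 0 := by
  rw [vec, descend_natCast h.frame_periodic]

theorem vec_add_one (a : CycleObj.{v} n) (i : Fin 2) :
    h.vec (a + 1) i = descend c a * h.vec a i - h.vec (a - 1) i := by
  obtain ⟨k, hk, rfl⟩ := exists_natCast_eq h.pos a 1
  obtain ⟨k, rfl⟩ : ∃ m, k = m + 1 := ⟨k - 1, by omega⟩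
  rw [← Nat.cast_succ, h.vec_natCast, h.vec_natCast, descend_natCast h.periodic_two_mul,
    Nat.cast_succ, add_sub_cancel_right, h.vec_natCast]
  exact frame_add_two c k i

theorem cross_vec_natCast (k l : ℕ) :
    cross (h.vec (k : CycleObj.{v} n)) (h.vec (l : CycleObj.{v} n)) = frameDet c k l := by
  simp only [cross, h.vec_natCast]
  rfl

theorem cross_vec_pred (a : CycleObj.{v} n) : cross (h.vec (a - 1)) (h.vec a) = 1 := by
  obtain ⟨k, hk, rfl⟩ := exists_natCast_eq h.pos a 1
  obtain ⟨k, rfl⟩ : ∃ m, k = m + 1 := ⟨k - 1, by omega⟩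
  rw [Nat.cast_succ, add_sub_cancel_right, ← Nat.cast_succ, cross_vec_natCast, frameDet_succ]

theorem apply_parity (a : CycleObj.{v} n) (x : ParityIndex.{u} →₀ ℤ) :
    x (parity a) = cross (h.vec (a - 1)) (h.toPlane a x) := by
  have := h.cross_vec_pred a
  unfold cross at *
  unfold toPlane
  linear_combination (-x (parity a)) * this

theorem apply_parity_add_one (a : CycleObj.{v} n) (x : ParityIndex.{u} →₀ ℤ) :
    x (parity a + 1) = cross (h.vec a) (h.toPlane a x) := by
  have := h.cross_vec_pred a
  unfold cross at *
  unfold toPlane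
  linear_combination (-x (parity a + 1)) * this

theorem toPlane_injective (a : CycleObj.{v} n) : Function.Injective (h.toPlane.{u, v} a) := by
  intro x y hxy
  ext k
  rcases parity_cover (parity a) k with rfl | rfl
  · rw [h.apply_parity, h.apply_parity, hxy]
  · rw [h.apply_parity_add_one, h.apply_parity_add_one, hxy]

theorem exists_toPlane_eq (a : CycleObj.{v} n) (w : Fin 2 → ℤ) :
    ∃ x, h.toPlane.{u, v} a x = w ∧ x (parity a) = cross (h.vec (a - 1)) w ∧
      x (parity a + 1) = cross (h.vec a) w := by
  set x := pairVec.{u} (parity a) (parity a + 1) ![cross (h.vec (a - 1)) w, cross (h.vec a) w]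
  have hx0 : x (parity a) = cross (h.vec (a - 1)) w :=
    pairVec_apply_left (add_one_ne _).symm _
  have hx1 : x (parity a + 1) = cross (h.vec a) w :=
    pairVec_apply_right (add_one_ne _).symm _
  refine ⟨x, ?_, hx0, hx1⟩
  have hdet := h.cross_vec_pred a
  funext i
  rw [toPlane, hx0, hx1]
  unfold cross at *
  fin_cases i
  · simp only [Fin.zero_eta]
    linear_combination (w 0) * hdet
  · simp only [Fin.mk_one]
    linear_combination (w 1) * hdet

end IsQuiddity

theorem CartanScheme.coroot_apply {I : Type u} {A : Type v} (C : CartanScheme I A) {i j : I}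
    (hij : i ≠ j) (hI : ∀ k, k = i ∨ k = j) (a : A) (x : I →₀ ℤ) :
    C.coroot i a x = 2 * x i + C.cartan a i j * x j := by
  conv_lhs => rw [eq_pairVec hij hI x]
  simp only [pairVec, map_add, map_zsmul, coroot_α, (C.isGenCartanMatrix a).diag]
  simp
  ring

theorem CartanScheme.σ_apply_left {I : Type u} {A : Type v} (C : CartanScheme I A) {i j : I}
    (hij : i ≠ j) (hI : ∀ k, k = i ∨ k = j) (a : A) (x : I →₀ ℤ) :
    C.σ i a x i = -x i - C.cartan a i j * x j := by
  rw [σ, Module.reflection_apply, C.coroot_apply hij hI]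
  simp [α]
  ring

theorem CartanScheme.σ_apply_right {I : Type u} {A : Type v} (C : CartanScheme I A) {i j : I}
    (hij : i ≠ j) (a : A) (x : I →₀ ℤ) : C.σ i a x j = x j := by
  rw [σ, Module.reflection_apply]
  simp [α, hij.symm]

namespace IsQuiddity

open CartanScheme

variable {n : ℕ} {c : ℕ → ℤ} (h : IsQuiddity n c)

/-- The reflections are changes of frame, so that every morphism of the Weyl groupoid is the
identity of the plane. -/
theorem toPlane_σ (i : ParityIndex.{u}) (a : CycleObj.{v} n) (x : ParityIndex.{u} →₀ ℤ) :
    h.toPlane (h.scheme.ρ i a) (h.scheme.σ i a x) = h.toPlane a x := by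
  funext k
  rcases parity_cover (parity a) i with rfl | rfl
  · have h1 := h.scheme.σ_apply_left (add_one_ne (parity a)).symm (parity_cover _) a x
    have h2 := h.scheme.σ_apply_right (add_one_ne (parity a)).symm a x
    rw [scheme_cartan_parity] at h1
    rw [scheme_ρ_parity, toPlane, toPlane, parity_add_one, add_one_add_one, h1, h2,
      add_sub_cancel_right, vec_add_one]
    ring
  · have h1 := h.scheme.σ_apply_left (add_one_ne (parity a))
      (fun k => (parity_cover _ k).symm) a x
    have h2 := h.scheme.σ_apply_right (add_one_ne (parity a)) a x
    have h3 := h.vec_add_one (a - 1) k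
    rw [sub_add_cancel] at h3
    rw [scheme_cartan_parity_add_one] at h1
    rw [scheme_ρ_parity_add_one, toPlane, toPlane, parity_sub_one, add_one_add_one, h1, h2, h3]
    ring

theorem toPlane_of_isMor {a b : CycleObj.{v} n}
    {f : (ParityIndex.{u} →₀ ℤ) ≃ₗ[ℤ] (ParityIndex.{u} →₀ ℤ)} (hf : h.scheme.IsMor a b f)
    (x : ParityIndex.{u} →₀ ℤ) : h.toPlane b (f x) = h.toPlane a x := by
  induction hf with
  | refl => rfl
  | step b f i _ ih => rw [LinearEquiv.trans_apply, toPlane_σ, ih]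

theorem scheme_isSimplyConnected : (h.scheme.{u, v}).IsSimplyConnected := fun a f => by
  apply Subtype.ext
  ext1 x
  exact h.toPlane_injective a (h.toPlane_of_isMor f.2 x)

theorem scheme_isConnected : (h.scheme.{u, v}).IsConnected := by
  have key : ∀ a : CycleObj.{v} n, ∃ f, h.scheme.{u, v}.IsMor 0 a f := fun a => by
    obtain ⟨k, -, rfl⟩ := exists_natCast_eq h.pos a 0
    obtain ⟨f, hf, -⟩ := h.scheme.{u, v}.exists_isMor_obj k (parity 0) (parity 0 + 1) 0
    rw [scheme_obj_forward, zero_add] at hf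
    exact ⟨f, hf⟩
  intro a b
  obtain ⟨f, hf⟩ := key a
  obtain ⟨g, hg⟩ := key b
  exact ⟨⟨_, hf.symm.trans hg⟩⟩

theorem scheme_isIrreducible : (h.scheme.{u, v}).IsIrreducible := by
  rintro a J ⟨i, hi⟩ ⟨j, hj⟩
  have hij : i ≠ j := fun e => hj (e ▸ hi)
  refine ⟨i, hi, j, hj, Or.inl ?_⟩
  have key : ∀ b : CycleObj.{v} n, 1 ≤ descend c b := fun b => h.one_le _
  have h1 := key a
  have h2 := key (a - 1)
  rcases parity_cover (parity a) i with rfl | rfl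
  · rw [eq_add_one_of_ne hij.symm, scheme_cartan_parity]
    omega
  · rw [eq_add_one_of_ne hij.symm, add_one_add_one, scheme_cartan_parity_add_one]
    omega

/-- The roots at `a`: the vectors `v_b` in the frame at `a`. -/
def roots (a : CycleObj.{v} n) : Set (ParityIndex.{u} →₀ ℤ) :=
  {x | ∃ b : CycleObj.{v} n, h.toPlane a x = h.vec b}

theorem vec_ne_zero (a : CycleObj.{v} n) : h.vec a ≠ 0 := fun h0 => by
  have := h.cross_vec_pred a
  simp [h0, cross] at this

theorem vec_add_self (a : CycleObj.{v} n) : h.vec (a + n) = -h.vec a := by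
  obtain ⟨k, -, rfl⟩ := exists_natCast_eq h.pos a 0
  funext i
  rw [← Nat.cast_add, Pi.neg_apply, vec_natCast, vec_natCast, h.frame_add]
  rfl

/-- The roots between `v_a` and `v_{a+n} = -v_a` are positive, the other ones are negative. -/
theorem sign_of_toPlane_eq {a : CycleObj.{v} n} {d : ℕ} {x : ParityIndex.{u} →₀ ℤ}
    (hx : h.toPlane a x = h.vec (a + d)) :
    (d < n → ∀ k, 0 ≤ x k) ∧ (n ≤ d → d < 2 * n → ∀ k, x k ≤ 0) := by
  obtain ⟨m, hm, rfl⟩ := exists_natCast_eq h.pos a 1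
  obtain ⟨m, rfl⟩ : ∃ m', m = m' + 1 := ⟨m - 1, by omega⟩
  have h1 := h.apply_parity ((m + 1 : ℕ) : CycleObj.{v} n) x
  have h2 := h.apply_parity_add_one ((m + 1 : ℕ) : CycleObj.{v} n) x
  rw [hx, ← Nat.cast_add] at h1 h2
  rw [cross_vec_natCast] at h2
  rw [Nat.cast_succ m, add_sub_cancel_right, cross_vec_natCast, ← Nat.cast_succ] at h1
  constructor
  · intro hd k
    rcases parity_cover (parity ((m + 1 : ℕ) : CycleObj.{v} n)) k with rfl | rfl
    · rw [h1]
      exact h.frameDet_nonneg (by omega) (by omega)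
    · rw [h2]
      exact h.frameDet_nonneg (by omega) (by omega)
  · intro hd hd2 k
    obtain ⟨e, rfl⟩ : ∃ e, d = e + n := ⟨d - n, by omega⟩
    rw [← add_assoc, h.frameDet_add_right] at h1 h2
    rcases parity_cover (parity ((m + 1 : ℕ) : CycleObj.{v} n)) k with rfl | rfl
    · rw [h1, neg_nonpos]
      exact h.frameDet_nonneg (by omega) (by omega)
    · rw [h2, neg_nonpos]
      exact h.frameDet_nonneg (by omega) (by omega)

theorem exists_add_natCast_eq (hn : 0 < n) (a b : CycleObj.{v} n) : ∃ d < 2 * n, b = a + d := by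
  have : NeZero (2 * n) := ⟨by omega⟩
  refine ⟨(b - a).down.val, ZMod.val_lt _, ?_⟩
  rw [eq_comm, ← eq_sub_iff_add_eq']
  apply ULift.ext
  rw [ULift.down_natCast, ZMod.natCast_zmod_val]

theorem toPlane_neg (a : CycleObj.{v} n) (x : ParityIndex.{u} →₀ ℤ) :
    h.toPlane a (-x) = -h.toPlane a x := by
  funext i
  simp [toPlane]
  ring

theorem neg_mem_roots {a : CycleObj.{v} n} {x : ParityIndex.{u} →₀ ℤ} (hx : x ∈ h.roots a) :
    -x ∈ h.roots a := by
  obtain ⟨b, hb⟩ := hx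
  exact ⟨b + n, by rw [toPlane_neg, hb, vec_add_self]⟩

theorem zsmul_mem_roots (a : CycleObj.{v} n) (i : ParityIndex.{u}) (z : ℤ) :
    z • α i ∈ h.roots a ↔ z = 1 ∨ z = -1 := by
  have hz : ∃ b : CycleObj.{v} n, ∀ z : ℤ, h.toPlane a (z • α i) = z • h.vec b := by
    rcases parity_cover (parity a) i with rfl | rfl
    · refine ⟨a, fun z => ?_⟩
      funext k
      simp [toPlane, α]
    · refine ⟨a - 1 + n, fun z => ?_⟩
      rw [vec_add_self]
      funext k
      simp [toPlane, α]
  obtain ⟨b, hb⟩ := hz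
  constructor
  · rintro ⟨b', hb'⟩
    rw [hb] at hb'
    have hdet := h.cross_vec_pred b'
    rw [← hb'] at hdet
    refine Int.eq_one_or_neg_one_of_mul_eq_one (v := cross (h.vec (b' - 1)) (h.vec b)) ?_
    rw [← hdet]
    simp [cross]
    ring
  · rintro (rfl | rfl)
    · exact ⟨b, by rw [hb, one_smul]⟩
    · exact ⟨b + n, by rw [hb, vec_add_self, neg_smul, one_smul]⟩

theorem ncard_positive_roots (a : CycleObj.{v} n) :
    (positivePart (h.roots.{u, v} a)).ncard = n := by
  have himage : h.toPlane a '' positivePart (h.roots.{u, v} a) =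
      (fun d : ℕ => h.vec (a + d)) '' Set.Iio n := by
    ext w
    constructor
    · rintro ⟨x, ⟨⟨b, hb⟩, hx0⟩, rfl⟩
      obtain ⟨d, hd, rfl⟩ := exists_add_natCast_eq h.pos a b
      refine ⟨d, ?_, hb.symm⟩
      by_contra hdn
      have hneg := (h.sign_of_toPlane_eq hb).2 (not_lt.1 hdn) hd
      have hx : x = 0 := by
        ext k
        exact le_antisymm (hneg k) (hx0 k)
      refine h.vec_ne_zero (a + d) ?_
      rw [← hb, hx]
      funext i
      simp [toPlane]
    · rintro ⟨d, hd, rfl⟩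
      obtain ⟨x, hx, -⟩ := h.exists_toPlane_eq.{u, v} a (h.vec (a + d))
      exact ⟨x, ⟨⟨_, hx⟩, (h.sign_of_toPlane_eq hx).1 hd⟩, hx⟩
  have hinj : Set.InjOn (fun d : ℕ => h.vec (a + d)) (Set.Iio n) := by
    obtain ⟨m, -, rfl⟩ := exists_natCast_eq h.pos a 0
    have key : ∀ d e : ℕ, d < e → e < n →
        h.vec ((m : CycleObj.{v} n) + d) ≠ h.vec ((m : CycleObj.{v} n) + e) := by
      intro d e hde he heq
      have hpos := h.frameDet_pos (k := m + d) (l := m + e) (by omega) (by omega)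
      rw [← h.cross_vec_natCast, Nat.cast_add, Nat.cast_add, heq, cross, mul_comm, sub_self] at hpos
      exact lt_irrefl _ hpos
    intro d hd e he hde
    rcases lt_trichotomy d e with hlt | heq | hlt
    · exact absurd hde (key d e hlt he)
    · exact heq
    · exact absurd hde.symm (key e d hlt hd)
  rw [← Set.ncard_image_of_injective _ (h.toPlane_injective a), himage, hinj.ncard_image]
  simp [← Nat.card_coe_set_eq]

theorem scheme_isRootSystem : (h.scheme.{u, v}).IsRootSystem h.roots where
  pos_or_neg a := by
    ext x
    constructor
    · rintro ⟨b, hb⟩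
      obtain ⟨d, hd, rfl⟩ := exists_add_natCast_eq h.pos a b
      rcases lt_or_ge d n with hdn | hdn
      · exact Or.inl ⟨⟨_, hb⟩, (h.sign_of_toPlane_eq hb).1 hdn⟩
      · refine Or.inr ⟨h.neg_mem_roots ⟨_, hb⟩, fun k => ?_⟩
        have := (h.sign_of_toPlane_eq hb).2 hdn hd k
        simpa using this
    · rintro (hx | hx)
      · exact hx.1
      · simpa using h.neg_mem_roots hx.1
  reduced a i := by
    ext x
    constructor
    · rintro ⟨hx, z, rfl⟩
      rcases (h.zsmul_mem_roots a i z).1 hx with rfl | rfl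
      · exact Or.inl (one_smul _ _)
      · exact Or.inr (by simp)
    · rintro (rfl | hx)
      · have := (h.zsmul_mem_roots a i 1).2 (Or.inl rfl)
        rw [one_smul] at this
        exact ⟨this, 1, (one_smul _ _).symm⟩
      · rw [Set.mem_singleton_iff.1 hx]
        have := (h.zsmul_mem_roots a i (-1)).2 (Or.inr rfl)
        rw [neg_smul, one_smul] at this
        exact ⟨this, -1, by simp⟩
  image_σ a i := by
    ext x
    constructor
    · rintro ⟨y, ⟨b, hb⟩, rfl⟩
      exact ⟨b, by rw [toPlane_σ, hb]⟩
    · rintro ⟨b, hb⟩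
      obtain ⟨y, rfl⟩ := (h.scheme.σ i a).surjective x
      exact ⟨y, ⟨b, by rw [← hb, toPlane_σ]⟩, rfl⟩
  iterate_ρ a i j hij _ := by
    rw [planePart_eq_positivePart hij (cover_of_ne hij), ncard_positive_roots, ← obj_two_mul]
    rcases parity_cover (parity a) j with rfl | rfl
    · rw [eq_add_one_of_ne hij, scheme_obj_forward, natCast_two_mul_self, add_zero]
    · rw [eq_add_one_of_ne hij, add_one_add_one, scheme_obj_backward, natCast_two_mul_self,
        sub_zero]

theorem scheme_hasFiniteRootSystem : (h.scheme.{u, v}).HasFiniteRootSystem := by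
  refine ⟨h.roots, h.scheme_isRootSystem, fun a => ?_⟩
  have : NeZero (2 * n) := ⟨by have := h.pos; omega⟩
  refine Set.Finite.of_finite_image (f := h.toPlane a) ?_ (h.toPlane_injective a).injOn
  refine (Set.finite_range (h.vec (n := n))).subset ?_
  rintro _ ⟨x, ⟨b, hb⟩, rfl⟩
  exact ⟨b, hb.symm⟩

end IsQuiddity

/-- The object of the classification belonging to a sequence in `𝒜⁺`. -/
noncomputable def UniversalRankTwo.ofQuiddity {n : ℕ} {c : ℕ → ℤ} (h : IsQuiddity n c) :
    UniversalRankTwo.{u, v} n where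
  I := ParityIndex.{u}
  A := CycleObj.{v} n
  scheme := h.scheme
  rank_two := by simp
  card_objects := by simp
  connected := h.scheme_isConnected
  simplyConnected := h.scheme_isSimplyConnected
  irreducible := h.scheme_isIrreducible
  finiteRootSystem := h.scheme_hasFiniteRootSystem

/-! ### The sequences of a cyclic scheme form one dihedral orbit -/

theorem dihedralRel_equivalence (n : ℕ) : Equivalence fun f f' : Fin n → ℤ =>
    ∃ g ∈ dihedralPerms n, ∀ k, f' k = f (g k) where
  refl f := ⟨1, one_mem _, fun _ => rfl⟩
  symm := by
    rintro f f' ⟨g, hg, h⟩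
    exact ⟨g⁻¹, inv_mem hg, fun k => by rw [h]; simp⟩
  trans := by
    rintro f f' f'' ⟨g, hg, h⟩ ⟨g', hg', h'⟩
    exact ⟨g * g', mul_mem hg hg', fun k => by rw [h', h]; rfl⟩

namespace CartanScheme

variable {I : Type u} {A : Type v} {C : CartanScheme I A} {i j : I} {n : ℕ}

theorem entrySeq_eq_ofFn (C : CartanScheme I A) (n : ℕ) (i j : I) (a : A) :
    C.entrySeq n i j a = List.ofFn fun k : Fin n => C.entry k i j a := by
  rw [entrySeq_eq]
  refine List.ext_getElem (by simp) fun k h1 h2 => ?_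
  simp

/-- A walk traversed backwards. -/
theorem entry_reverse (C : CartanScheme I A) (i j : I) (a : A) (k m : ℕ) :
    C.entry k (alternate (m + k) i j) (alternate (m + k) j i) (C.obj (m + k + 1) i j a) =
      C.entry m i j a := by
  induction k with
  | zero =>
    rw [entry, entry, add_zero, obj, obj_succ, alternate, alternate, ← C.cartan_ρ]
  | succ k ih =>
    rw [← ih, ← C.ρ_obj_succ (m + k + 1) i j a]
    rfl

namespace IsCyclic

theorem obj_two_mul_self (h : C.IsCyclic n) (hij : i ≠ j) (a : A) : C.obj (2 * n) i j a = a :=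
  (h.obj_eq_iff i j a hij (2 * n) 0).2 (by simp [Nat.ModEq])

theorem entry_step (h : C.IsCyclic n) (hij : i ≠ j) (a : A) (k : Fin n) :
    C.entry k j i (C.ρ i a) = C.entry (finRotate n k) i j a := by
  rw [val_finRotate]
  split_ifs with hk
  · have := h.entry_add i j a hij 0
    rw [zero_add] at this
    rw [← this]
    exact congrArg (fun m => C.entry m i j a) hk
  · rfl

theorem entry_swap (h : C.IsCyclic n) (hij : i ≠ j) (a : A) (k : Fin n) :
    C.entry k j i a = C.entry (Fin.revPerm k) i j a := by
  have hk := k.isLt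
  obtain ⟨m, hm⟩ : ∃ m, n = m + k + 1 := ⟨n - 1 - k, by omega⟩
  have key := C.entry_reverse i j a k (m + n)
  have e : m + n + k + 1 = 2 * n := by omega
  have ea : alternate (m + n + k) i j = j := by
    rw [← alternate_succ, e, alternate_even]
  have eb : alternate (m + n + k) j i = i := by
    rw [← alternate_succ, e, alternate_even]
  rw [e, ea, eb, h.obj_two_mul_self hij, h.entry_add i j a hij] at key
  rw [key, Fin.revPerm_apply, Fin.val_rev]
  congr 1
  omega

/-- Any two sequences of a cyclic scheme are related by a dihedral symmetry. -/
theorem entry_related (h : C.IsCyclic n) (hI : Nat.card I = 2) {i' j' : I} (hij : i ≠ j)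
    (hij' : i' ≠ j') (a b : A) :
    ∃ g ∈ dihedralPerms n, ∀ k : Fin n, C.entry k i' j' b = C.entry (g k) i j a := by
  have hrot : finRotate n ∈ dihedralPerms n := Subgroup.subset_closure (by simp)
  have hrev : Fin.revPerm ∈ dihedralPerms n := Subgroup.subset_closure (by simp)
  have key : ∀ m, ∃ g ∈ dihedralPerms n, ∀ k : Fin n,
      C.entry k (alternate m i j) (alternate m j i) (C.obj m i j a) = C.entry (g k) i j a := by
    intro m
    induction m with
    | zero => exact ⟨1, one_mem _, fun _ => rfl⟩
    | succ m ih =>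
      refine (dihedralRel_equivalence n).trans (y := fun k : Fin n => C.entry k (alternate m i j)
        (alternate m j i) (C.obj m i j a)) (x := fun k : Fin n => C.entry k i j a) ih ?_
      exact ⟨_, hrot, fun k => by
        rw [C.obj_succ]
        exact h.entry_step (alternate_ne m hij) _ k⟩
  obtain ⟨m, rfl⟩ := h.exists_obj i j a hij b
  have hne := alternate_ne m hij
  have hcov := eq_or_eq_of_card_eq_two hI hne
  rcases hcov i' with rfl | rfl
  · rw [(hcov j').resolve_left hij'.symm]
    exact key m
  · rw [(hcov j').resolve_right hij'.symm]
    exact (dihedralRel_equivalence n).trans (y := fun k : Fin n => C.entry k (alternate m i j)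
        (alternate m j i) (C.obj m i j a)) (x := fun k : Fin n => C.entry k i j a) (key m)
        ⟨_, hrev, h.entry_swap hne _⟩

/-- The dihedral group maps sequences of a cyclic scheme to sequences of the same scheme. -/
theorem exists_entry_eq (h : C.IsCyclic n) {g : Equiv.Perm (Fin n)} (hg : g ∈ dihedralPerms n)
    (hij : i ≠ j) (a : A) :
    ∃ i' j' a', i' ≠ j' ∧ ∀ k : Fin n, C.entry k i' j' a' = C.entry (g k) i j a := by
  have key : (∀ i j a, i ≠ j → ∃ i' j' a', i' ≠ j' ∧
        ∀ k : Fin n, C.entry k i' j' a' = C.entry (g k) i j a) ∧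
      ∀ i j a, i ≠ j → ∃ i' j' a', i' ≠ j' ∧
        ∀ k : Fin n, C.entry k i' j' a' = C.entry (g⁻¹ k) i j a := by
    induction hg using Subgroup.closure_induction with
    | mem g hg =>
      rcases hg with rfl | rfl
      · refine ⟨fun i j a hij => ⟨j, i, C.ρ i a, hij.symm, h.entry_step hij a⟩,
          fun i j a hij => ⟨j, i, C.ρ j a, hij.symm, fun k => ?_⟩⟩
        have := h.entry_step hij.symm (C.ρ j a) ((finRotate n)⁻¹ k)
        rw [C.ρ_ρ, show finRotate n ((finRotate n)⁻¹ k) = k from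
          Equiv.apply_symm_apply _ k] at this
        exact this.symm
      · refine ⟨fun i j a hij => ⟨j, i, a, hij.symm, h.entry_swap hij a⟩,
          fun i j a hij => ⟨j, i, a, hij.symm, h.entry_swap hij a⟩⟩
    | one =>
      exact ⟨fun i j a hij => ⟨i, j, a, hij, fun _ => rfl⟩,
        fun i j a hij => ⟨i, j, a, hij, fun _ => by simp⟩⟩
    | mul g g' _ _ ih ih' =>
      constructor
      · intro i j a hij
        obtain ⟨i₁, j₁, a₁, h₁, e₁⟩ := ih.1 i j a hij
        obtain ⟨i₂, j₂, a₂, h₂, e₂⟩ := ih'.1 i₁ j₁ a₁ h₁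
        exact ⟨i₂, j₂, a₂, h₂, fun k => by rw [e₂, e₁]; rfl⟩
      · intro i j a hij
        obtain ⟨i₁, j₁, a₁, h₁, e₁⟩ := ih'.2 i j a hij
        obtain ⟨i₂, j₂, a₂, h₂, e₂⟩ := ih.2 i₁ j₁ a₁ h₁
        exact ⟨i₂, j₂, a₂, h₂, fun k => by rw [e₂, e₁, mul_inv_rev]; rfl⟩
    | inv g _ ih => exact ⟨ih.2, by simpa using ih.1⟩
  exact key.1 i j a hij

/-- A cyclic scheme is determined up to equivalence by any of its sequences. -/
theorem equivalent {I' : Type u} {A' : Type v} {C' : CartanScheme I' A'} (h : C.IsCyclic n)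
    (h' : C'.IsCyclic n) (hI : Nat.card I = 2) (hI' : Nat.card I' = 2) {i' j' : I'} (hij : i ≠ j)
    (hij' : i' ≠ j') (a : A) (a' : A')
    (hentry : ∀ k : Fin n, C.entry k i j a = C'.entry k i' j' a') : C.Equivalent C' := by
  classical
  have hn := h.three_le hij
  have hcov := eq_or_eq_of_card_eq_two hI hij
  have hcov' := eq_or_eq_of_card_eq_two hI' hij'
  have hentry' : ∀ k, C.entry k i j a = C'.entry k i' j' a' := fun k => by
    have e1 : C.entry (k % n) i j a = C.entry k i j a :=
      Function.Periodic.map_mod_nat (f := fun k => C.entry k i j a) (h.entry_add i j a hij) k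
    have e2 : C'.entry (k % n) i' j' a' = C'.entry k i' j' a' :=
      Function.Periodic.map_mod_nat (f := fun k => C'.entry k i' j' a')
        (h'.entry_add i' j' a' hij') k
    rw [← e1, ← e2]
    exact hentry ⟨k % n, Nat.mod_lt _ (by omega)⟩
  -- the bijection of the index sets
  set e₀ : I → I' := fun k => if k = i then i' else j' with he₀
  have ei : e₀ i = i' := if_pos rfl
  have ej : e₀ j = j' := if_neg hij.symm
  have he₀bij : Function.Bijective e₀ := by
    constructor
    · intro k l hkl
      rcases hcov k with rfl | rfl <;> rcases hcov l with rfl | rfl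
      · rfl
      · rw [ei, ej] at hkl
        exact absurd hkl hij'
      · rw [ei, ej] at hkl
        exact absurd hkl.symm hij'
      · rfl
    · intro k
      rcases hcov' k with rfl | rfl
      · exact ⟨i, ei⟩
      · exact ⟨j, ej⟩
  -- the bijection of the sets of objects
  choose pos hpos using h.exists_obj i j a hij
  set φ₀ : A → A' := fun b => C'.obj (pos b) i' j' a' with hφ₀
  have hφ : ∀ k, φ₀ (C.obj k i j a) = C'.obj k i' j' a' := fun k =>
    (h'.obj_eq_iff i' j' a' hij' _ _).2 ((h.obj_eq_iff i j a hij _ _).1 (hpos _))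
  have hφbij : Function.Bijective φ₀ := by
    constructor
    · intro b b' hb
      have := (h'.obj_eq_iff i' j' a' hij' _ _).1 hb
      rw [← hpos b, ← hpos b']
      exact (h.obj_eq_iff i j a hij _ _).2 this
    · intro b'
      obtain ⟨k, rfl⟩ := h'.exists_obj i' j' a' hij' b'
      exact ⟨_, hφ k⟩
  have halt : ∀ k, e₀ (alternate k i j) = alternate k i' j' ∧
      e₀ (alternate k j i) = alternate k j' i' := fun k => by
    rw [← alternate_map e₀, ← alternate_map e₀, ei, ej]
    exact ⟨rfl, rfl⟩
  have hsucc : ∀ b, ∃ m, b = C.obj (m + 1) i j a := fun b => by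
    obtain ⟨m, hm⟩ : ∃ m, pos b + 2 * n = m + 1 := Nat.exists_eq_succ_of_ne_zero (by omega)
    refine ⟨m, ?_⟩
    rw [← hm]
    conv_lhs => rw [← hpos b]
    exact (h.obj_eq_iff i j a hij _ _).2 (by simp [Nat.ModEq])
  refine ⟨Equiv.ofBijective e₀ he₀bij, Equiv.ofBijective φ₀ hφbij, ?_, ?_⟩
  · intro l b
    simp only [Equiv.ofBijective_apply]
    obtain ⟨m, rfl⟩ := hsucc b
    rcases alternate_cover hcov (m + 1) l with rfl | rfl
    · rw [← C.obj_succ, hφ, hφ, (halt _).1, ← C'.obj_succ]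
    · rw [alternate_succ, C.ρ_obj_succ, hφ, hφ, (halt _).1, C'.ρ_obj_succ]
  · intro l l' b
    simp only [Equiv.ofBijective_apply]
    by_cases hll : l = l'
    · rw [hll, (C.isGenCartanMatrix b).diag, (C'.isGenCartanMatrix _).diag]
    obtain ⟨m, rfl⟩ := hsucc b
    rw [hφ]
    have hcovm := alternate_cover hcov (m + 1)
    rcases hcovm l with rfl | rfl
    · rw [(hcovm l').resolve_left (Ne.symm hll), (halt _).1, (halt _).2]
      exact (neg_injective (hentry' (m + 1))).symm
    · rw [(hcovm l').resolve_right (Ne.symm hll), (halt _).1, (halt _).2, alternate_succ,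
        alternate_succ, alternate_succ, alternate_succ, C.obj_succ, C'.obj_succ, ← C.cartan_ρ,
        ← C'.cartan_ρ]
      exact (neg_injective (hentry' m)).symm

end IsCyclic

theorem entry_of_equiv {I' : Type u} {A' : Type v} {C' : CartanScheme I' A'} (e : I ≃ I')
    (φ : A ≃ A') (hρ : ∀ i a, φ (C.ρ i a) = C'.ρ (e i) (φ a))
    (hc : ∀ i j a, C'.cartan (φ a) (e i) (e j) = C.cartan a i j) (k : ℕ) (i j : I) (a : A) :
    C'.entry k (e i) (e j) (φ a) = C.entry k i j a := by
  have hobj : ∀ k i j a, C'.obj k (e i) (e j) (φ a) = φ (C.obj k i j a) := by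
    intro k
    induction k with
    | zero => exact fun _ _ _ => rfl
    | succ k ih => exact fun i j a => by rw [obj, ← hρ, ih, obj]
  rw [entry, entry, hobj, alternate_map, alternate_map, hc]

end CartanScheme

/-! ### Equivalence classes of schemes and of triangulations -/

namespace UniversalRankTwo

open CartanScheme

variable {n : ℕ}

theorem isCyclic (X : UniversalRankTwo.{u, v} n) : X.scheme.IsCyclic n := by
  obtain ⟨m, hm⟩ := exists_isCyclic X.rank_two X.connected X.simplyConnected X.irreducible
    X.finiteRootSystem
  obtain ⟨i, j, hij, -⟩ := Nat.card_eq_two_iff.1 X.rank_two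
  have h1 := hm.card_objects hij
  have h2 := X.card_objects
  obtain rfl : m = n := by omega
  exact hm

/-- The triangulation `T` has the sequence of the walk from `a` in the directions `i, j, i, …` as
its numbers of triangles. -/
def Realizes (X : UniversalRankTwo.{u, v} n) (i j : X.I) (a : X.A) (T : Triangulation n) : Prop :=
  ∀ k, (T.numTriangles k : ℤ) = X.scheme.entry k i j a

theorem exists_realizes (X : UniversalRankTwo.{u, v} n) (hn : 3 ≤ n) {i j : X.I} (hij : i ≠ j)
    (a : X.A) : ∃ T, X.Realizes i j a T :=
  Triangulation.exists_of_isAPlus hn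
    (X.scheme.entrySeq_eq_ofFn n i j a ▸ X.isCyclic.isAPlus i j a hij)

theorem triangulation_equiv (hn : 3 ≤ n) {X Y : UniversalRankTwo.{u, v} n} (hXY : X ≈ Y)
    {i j : X.I} {i' j' : Y.I} (hij : i ≠ j) (hij' : i' ≠ j') {a : X.A} {b : Y.A}
    {S T : Triangulation n} (hS : X.Realizes i j a S) (hT : Y.Realizes i' j' b T) : S ≈ T := by
  obtain ⟨e, φ, hρ, hc⟩ := hXY
  obtain ⟨g, hg, h⟩ := Y.isCyclic.entry_related Y.rank_two hij' (e.injective.ne hij) b (φ a)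
  rw [Triangulation.equiv_iff hn]
  refine ⟨g, hg, fun k => ?_⟩
  have : (S.numTriangles k : ℤ) = T.numTriangles (g k) := by
    rw [hS, hT, ← h, entry_of_equiv e φ hρ hc]
  exact_mod_cast this

theorem equiv_of_triangulation_equiv (hn : 3 ≤ n) {X Y : UniversalRankTwo.{u, v} n}
    {i j : X.I} {i' j' : Y.I} (hij : i ≠ j) (hij' : i' ≠ j') {a : X.A} {b : Y.A}
    {S T : Triangulation n} (hS : X.Realizes i j a S) (hT : Y.Realizes i' j' b T)
    (hST : S ≈ T) : X ≈ Y := by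
  obtain ⟨g, hg, h⟩ := (Triangulation.equiv_iff hn S T).1 hST
  obtain ⟨i₁, j₁, b₁, h₁, e₁⟩ := Y.isCyclic.exists_entry_eq hg hij' b
  refine X.isCyclic.equivalent Y.isCyclic X.rank_two Y.rank_two hij h₁ a b₁ fun k => ?_
  rw [e₁, ← hT, ← h, hS]

theorem exists_of_triangulation (hn : 3 ≤ n) (T : Triangulation n) :
    ∃ (X : UniversalRankTwo.{u, v} n) (i j : X.I) (a : X.A), i ≠ j ∧ X.Realizes i j a T := by
  have : NeZero n := ⟨by omega⟩
  set c : ℕ → ℤ := fun k => T.numTriangles (Fin.ofNat n k) with hc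
  have hlist : (List.range n).map c = List.ofFn fun k => (T.numTriangles k : ℤ) := by
    refine List.ext_getElem (by simp) fun k h1 h2 => ?_
    have hk : k < n := by simpa using h2
    have : Fin.ofNat n k = ⟨k, hk⟩ := Fin.ext (Nat.mod_eq_of_lt hk)
    simp only [hc, List.getElem_map, List.getElem_range, List.getElem_ofFn, this]
  have hq : IsQuiddity n c :=
    { periodic := fun k => by
        have : Fin.ofNat n (k + n) = Fin.ofNat n k := Fin.ext (Nat.add_mod_right k n)
        simp only [hc, this]
      isAPlus := hlist ▸ T.isAPlus hn }
  refine ⟨ofQuiddity hq, (0 : ParityIndex.{u}), (1 : ParityIndex.{u}), (0 : CycleObj.{v} n),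
    ?_, fun k => ?_⟩
  · intro h
    exact absurd (congrArg ULift.down h) (by decide)
  · have := hq.scheme_entrySeq.{u, v}
    rw [hlist, entrySeq_eq_ofFn] at this
    exact (congrFun (List.ofFn_injective this) k).symm

end UniversalRankTwo

/-! ### The classification -/

theorem PolygonTriangulation.triangleSeq_injective :
    Function.Injective PolygonTriangulation.triangleSeq := by
  rintro ⟨⟨m, hm⟩, S⟩ ⟨⟨n, hn⟩, T⟩ h
  obtain rfl : m = n := by simpa [triangleSeq] using congrArg List.length h
  have h' := List.ofFn_injective h
  rw [Triangulation.eq_of_numTriangles_eq hm (S := S) (T := T) fun i => by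
    exact_mod_cast congrFun h' i]

theorem PolygonTriangulation.isAPlus (T : PolygonTriangulation) : IsAPlus T.triangleSeq :=
  T.2.isAPlus T.1.2

theorem PolygonTriangulation.exists_triangleSeq_eq {c : List ℤ} (h : IsAPlus c) :
    ∃ T : PolygonTriangulation, T.triangleSeq = c := by
  obtain ⟨T, hT⟩ := Triangulation.exists_of_isAPlus (f := c.get) h.three_le_length
    (by rwa [List.ofFn_get])
  refine ⟨⟨⟨_, h.three_le_length⟩, T⟩, ?_⟩
  exact (congrArg List.ofFn (funext hT)).trans (List.ofFn_get c)

theorem theorem3p5 :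
    (∀ c : List ℤ, IsAPlus c ↔ IsEtaSeq c) ∧
    ∃ Ψ : {c : List ℤ // IsAPlus c} → PolygonTriangulation,
      (∀ c, (Ψ c).triangleSeq = c.1) ∧
      (∀ c T, T.triangleSeq = c.1 → T = Ψ c) ∧
      Function.Bijective Ψ ∧
      (∀ (I : Type u) (A : Type v) (C : CartanScheme I A), Nat.card I = 2 →
        C.IsConnected → C.IsSimplyConnected → C.IsIrreducible → C.HasFiniteRootSystem →
        ∃ n, 3 ≤ n ∧ Nat.card A = 2 * n) ∧
      ∀ (n : ℕ) (hn : 3 ≤ n),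
        ∃ F : Quotient (UniversalRankTwo.setoid.{u, v} n) → Quotient (Triangulation.setoid n),
          Function.Bijective F ∧
          ∀ (X : UniversalRankTwo.{u, v} n) (i j : X.I) (a : X.A), i ≠ j →
            ∃ (h : IsAPlus (X.scheme.entrySeq n i j a)) (T : Triangulation n),
              Ψ ⟨X.scheme.entrySeq n i j a, h⟩ = ⟨⟨n, hn⟩, T⟩ ∧ F ⟦X⟧ = ⟦T⟧ := by
  refine ⟨isAPlus_iff_isEtaSeq, ?_⟩
  choose Ψ hΨ using fun c : {c : List ℤ // IsAPlus c} =>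
    PolygonTriangulation.exists_triangleSeq_eq c.2
  have huniq : ∀ c T, T.triangleSeq = c.1 → T = Ψ c := fun c T h =>
    PolygonTriangulation.triangleSeq_injective (h.trans (hΨ c).symm)
  refine ⟨Ψ, hΨ, huniq, ⟨fun c d hcd => ?_, fun T => ⟨⟨_, T.isAPlus⟩, (huniq _ T rfl).symm⟩⟩,
    fun I A C hI hconn hsc hirr hfin => ?_, fun n hn => ?_⟩
  · exact Subtype.ext (by rw [← hΨ c, ← hΨ d, hcd])
  · obtain ⟨n, h⟩ := CartanScheme.exists_isCyclic hI hconn hsc hirr hfin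
    obtain ⟨i, j, hij, -⟩ := Nat.card_eq_two_iff.1 hI
    exact ⟨n, h.three_le hij, h.card_objects hij⟩
  · have hex : ∀ X : UniversalRankTwo.{u, v} n, ∃ (T : Triangulation n) (i j : X.I) (a : X.A),
        i ≠ j ∧ X.Realizes i j a T := fun X => by
      obtain ⟨i, j, hij, -⟩ := Nat.card_eq_two_iff.1 X.rank_two
      obtain ⟨a⟩ := X.scheme.nonempty
      obtain ⟨T, hT⟩ := X.exists_realizes hn hij a
      exact ⟨T, i, j, a, hij, hT⟩
    choose τ i₀ j₀ a₀ hne hreal using hex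
    refine ⟨Quotient.lift (fun X => (⟦τ X⟧ : Quotient (Triangulation.setoid n))) fun X Y hXY =>
      Quotient.sound (UniversalRankTwo.triangulation_equiv hn hXY (hne X) (hne Y) (hreal X)
        (hreal Y)), ⟨?_, ?_⟩, ?_⟩
    · intro x y
      induction x using Quotient.inductionOn with | _ X => ?_
      induction y using Quotient.inductionOn with | _ Y => ?_
      intro hxy
      exact Quotient.sound (UniversalRankTwo.equiv_of_triangulation_equiv hn (hne X) (hne Y)
        (hreal X) (hreal Y) (Quotient.exact hxy))
    · intro t
      induction t using Quotient.inductionOn with | _ T => ?_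
      obtain ⟨X, i, j, a, hij, hT⟩ := UniversalRankTwo.exists_of_triangulation hn T
      exact ⟨⟦X⟧, Quotient.sound (UniversalRankTwo.triangulation_equiv hn (Setoid.refl X) (hne X)
        hij (hreal X) hT)⟩
    · intro X i j a hij
      have hA := X.isCyclic.isAPlus i j a hij
      obtain ⟨T, hT⟩ := X.exists_realizes hn hij a
      refine ⟨hA, T, (huniq _ _ ?_).symm, Quotient.sound
        (UniversalRankTwo.triangulation_equiv hn (Setoid.refl X) (hne X) hij (hreal X) hT)⟩
      exact (congrArg List.ofFn (funext hT)).trans (X.scheme.entrySeq_eq_ofFn n i j a).symm
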